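/- **Setting.** Let $n\in\mathbb N$, let $\mathcal T$ be a finite set of types, let player $i\in[n]$ have a finite set of actions $A_i$ that contains a null action $\bot$ ("opting out"), put $A=\prod_i A_i$, and let $u_i(\tau,\mathbf a)\in\mathbb R$ be the payoff of player $i$ if her type is $\tau\in\mathcal T$ and the action profile is $\mathbf a\in A$. Let $\varepsilon,\delta,\lambda,\beta\in(0,1]$ and suppose that the game is $\lambda$-large: $|u_{i'}(\tau,(a_i,a_{-i}))-u_{i'}(\tau,(a_i',a_{-i}))|\le\lambda$ for all players $i\ne i'$, all $\tau$, $a_i,a_i'$ and $a_{-i}$. Each player $i$ reports $x_i\in\mathcal T\cup\{\bot\}$. For each $i$ let $\mathcal A_i:\Delta(A_i)\times\mathbb R^{A_i}\to\Delta(A_i)$ be an arbitrary (measurable) online learning algorithm (for instance a no-regret algorithm), which maps a mixed strategy and a vector of losses to a new mixed strategy. *Privacy.* A randomized mechanism $\mathcal M$ that receives the reports and gives an output to each player is $(\varepsilon,\delta)$-jointly differentially private if for every $i$, all $x_i,x_i'$ and $x_{-i}$, and every measurable set $B$ of output profiles of the other players, $$\Pr[\mathcal M(x_i,x_{-i})_{-i}\in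 B]\le e^{\varepsilon}\Pr[\mathcal M(x_i',x_{-i})_{-i}\in B]+\delta .$$ A query is a function $Q:(\mathcal T\cup\{\bot\})^n\to\mathbb R$; it is $\lambda$-sensitive if a change of one report changes its value by at most $\lambda$. *Median Mechanism.* Let $c=\lfloor n\log_2(|\mathcal T|+1)\rfloor+1$, $s=\frac{\lambda}{\varepsilon}\sqrt{8c\log(4/\delta)}$, and let $R$ be the number of queries. The Median Mechanism holds $x$, keeps a set $S$ of candidate profiles, at first $S=(\mathcal T\cup\{\bot\})^n$, and draws $\rho\sim\mathrm{Lap}(4s)$. On a query $Q$ it computes the lower median $\mathrm{med}$ of $Q$ over $S$ and draws $\nu\sim\mathrm{Lap}(8s)$. If $|Q(x)-\mathrm{med}|+\nu<16s\log(3R/\beta)+\rho$, it answers $\mathrm{med}$. Otherwise it answers $a=Q(x)+z$ with $z\sim\mathrm{Lap}(2s)$, replaces $S$ by $\{d\in S:Q(d)>\mathrm{med}\}$ if $a>\mathrm{med}$ and by $\{d\in S:Q(d)<\mathrm{med}\}$ if not, and draws a new $\rho$. All draws are independent. After $c$ rounds of the second kind it answers every query with $\mathrm{med}$. *NRMEDIAN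 with $N$ rounds.* Given tables $\Lambda_1,\Lambda_2,\dots$ with entries $\Lambda^j_{i,s,\hat\tau}$ ($i\in[n]$, $j\in A_i$, $\hat\tau\in\mathcal T$), the strategies of player $i$ with report $x_i=\tau_i\in\mathcal T$ are $\pi_{i,1}=$ uniform on $A_i$ and $\pi_{i,s+1}=\mathcal A_i\big(\pi_{i,s},(\Lambda^j_{i,s,\tau_i})_{j\in A_i}\big)$; if $x_i=\bot$, then $\pi_{i,s}$ is the point mass on the null action for every $s$. 1. *Inner stage.* For $t=1,\dots,N$, and for all $(i,j,\hat\tau)$ in a fixed order, a single run of the query-answering mechanism $\mathcal M_M$ (with $R$ the total number of queries) answers the query $$Q^j_{i,t,\hat\tau}(x\mid\widehat\Lambda_1,\dots,\widehat\Lambda_{t-1})=1-\mathbb E_{a_{-i}\sim\pi_{-i,t}}\big[u_i(\hat\tau,(j,a_{-i}))\big],$$ where $\pi_{i',t}$ is computed from $\widehat\Lambda_1,\dots,\widehat\Lambda_{t-1}$ and $x_{i'}$, and the $a_{i'}$ are independent. The answer is stored as $\widehat\Lambda^j_{i,t,\hat\tau}$. 2. *Outer stage.* Each player $i$ receives the strategies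 $(\pi_{i,1},\dots,\pi_{i,N})$ computed from her own report and $\widehat\Lambda_1,\dots,\widehat\Lambda_N$. **Theorem (Privacy of NRMEDIAN).** For every number of rounds $N$ and every order of the queries within a round, NRMEDIAN with $\mathcal M_M$ the Median Mechanism is $(\varepsilon,\delta)$-jointly differentially private. Moreover, NRMEDIAN is $(\varepsilon,\delta)$-jointly differentially private with any other query-answering mechanism $\mathcal M_M$ whose transcript of $R$ rounds is $(\varepsilon,\delta)$-differentially private in the reports against every adaptive (measurable) querier that asks $\lambda$-sensitive queries. -/

import Mathlib

open MeasureTheory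

/-! ### Differential privacy

A randomized mechanism is a function `M` of the reports and of random coins `ω`, where the coins
have law `P`.  The players are `Fin n` and `X` is the set of possible reports. -/

/-- `(ε, δ)`-differential privacy. -/
def IsDifferentiallyPrivate {n : ℕ} {X Ω O : Type*} [MeasurableSpace Ω] [MeasurableSpace O]
    (ε δ : ℝ) (P : Measure Ω) (M : (Fin n → X) → Ω → O) : Prop :=
  ∀ (i : Fin n) (x : Fin n → X) (y : X) (B : Set O), MeasurableSet B →
    P {ω | M x ω ∈ B} ≤
      ENNReal.ofReal (Real.exp ε) * P {ω | M (Function.update x i y) ω ∈ B} + ENNReal.ofReal δ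

/-- `(ε, δ)`-joint differential privacy, for a mechanism that gives an output in `O j` to each
player `j`: if player `i` changes her report, the joint law of the outputs of all the players
`j ≠ i` hardly changes. -/
def IsJointlyDifferentiallyPrivate {n : ℕ} {X Ω : Type*} {O : Fin n → Type*} [MeasurableSpace Ω]
    [∀ j, MeasurableSpace (O j)] (ε δ : ℝ) (P : Measure Ω)
    (M : (Fin n → X) → Ω → (j : Fin n) → O j) : Prop :=
  ∀ (i : Fin n) (x : Fin n → X) (y : X) (B : Set ((j : {j : Fin n // j ≠ i}) → O j)),
    MeasurableSet B →
    P {ω | (fun j : {j : Fin n // j ≠ i} => M x ω j) ∈ B} ≤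
      ENNReal.ofReal (Real.exp ε) *
          P {ω | (fun j : {j : Fin n // j ≠ i} => M (Function.update x i y) ω j) ∈ B} +
        ENNReal.ofReal δ

/-! ### Answering adaptively chosen queries -/

/-- A real-valued query about a profile of reports. -/
abbrev Query (n : ℕ) (X : Type*) := (Fin n → X) → ℝ

/-- A query is `lam`-sensitive if no player can change its value by more than `lam`. -/
def IsSensitive {n : ℕ} {X : Type*} (lam : ℝ) (Q : Query n X) : Prop :=
  ∀ (i : Fin n) (x : Fin n → X) (y : X), |Q x - Q (Function.update x i y)| ≤ lam

/-- A stateful randomized mechanism that holds a profile of reports and answers queries one at a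
time.  In every round it draws a fresh coin of law `law`, independent of the earlier ones; from
the profile, the coin, its current state and the query, it computes its new state and its
answer. -/
structure OnlineMechanism (n : ℕ) (X : Type*) where
  Coin : Type*
  [measurableSpaceCoin : MeasurableSpace Coin]
  law : Measure Coin
  State : Type*
  init : State
  step : (Fin n → X) → Coin → State → Query n X → State × ℝ

attribute [instance] OnlineMechanism.measurableSpaceCoin

namespace OnlineMechanism

variable {n : ℕ} {X : Type*}

/-- The law of the coins of `R` rounds. -/
noncomputable def coins (M : OnlineMechanism n X) (R : ℕ) : Measure (Fin R → M.Coin) :=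
  Measure.pi fun _ => M.law

/-- One round of the interaction with a querier `q`, which chooses the next query from the list of
all the answers that were given so far.  (The earlier queries are functions of these answers.) -/
def round (M : OnlineMechanism n X) (q : List ℝ → Query n X) (x : Fin n → X)
    (p : M.State × List ℝ) (c : M.Coin) : M.State × List ℝ :=
  ((M.step x c p.1 (q p.2)).1, p.2 ++ [(M.step x c p.1 (q p.2)).2])

/-- The answers, in order, that the mechanism gives to the querier `q` in `R` rounds when it holds
the profile `x` and its coins are `ω`. -/
def answers (M : OnlineMechanism n X) (q : List ℝ → Query n X) {R : ℕ} (x : Fin n → X)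
    (ω : Fin R → M.Coin) : List ℝ :=
  ((List.ofFn ω).foldl (M.round q x) (M.init, [])).2

/-- The transcript of `R` rounds is `(ε, δ)`-differentially private against every adaptive querier
that asks `lam`-sensitive queries (and chooses them measurably).  As the queries are functions of
the answers, the transcript is recorded by the answers. -/
def IsPrivate (M : OnlineMechanism n X) (ε δ lam : ℝ) (R : ℕ) : Prop :=
  ∀ q : List ℝ → Query n X, (∀ h, IsSensitive lam (q h)) →
    (∀ (r : ℕ) (x : Fin n → X), Measurable fun a : Fin r → ℝ => q (List.ofFn a) x) →
    IsDifferentiallyPrivate ε δ (M.coins R)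
      (fun (x : Fin n → X) ω (r : Fin R) => (M.answers q x ω).getD r 0)

end OnlineMechanism

/-! ### The Median Mechanism -/

/-- The Laplace distribution with parameter `b > 0`. -/
noncomputable def laplaceMeasure (b : ℝ) : Measure ℝ :=
  volume.withDensity fun z => ENNReal.ofReal (1 / (2 * b) * Real.exp (-|z| / b))

/-- The (lower) median of the values of `Q` on a nonempty finite set `S`. -/
noncomputable def medianOn {D : Type*} (S : Finset D) (Q : D → ℝ) : ℝ :=
  sInf {m : ℝ | S.card ≤ 2 * (S.filter fun d => Q d ≤ m).card}

/-- The number of hard rounds after which the Median Mechanism halts.  Every hard round at least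
halves the set of candidate profiles. -/
noncomputable def maxHardRounds (n : ℕ) (X : Type*) [Fintype X] : ℕ :=
  Nat.log 2 (Fintype.card X ^ n) + 1

/-- The noise scale `lam / ε₀` of the Median Mechanism, where `ε₀ = ε / √(8 c log (4 / δ))` is the
privacy budget of each of the `c` hard rounds and of the easy rounds that precede it. -/
noncomputable def noiseScale (n : ℕ) (X : Type*) [Fintype X] (ε δ lam : ℝ) : ℝ :=
  lam / ε * Real.sqrt (8 * maxHardRounds n X * Real.log (4 / δ))

/-- The internal state of the Median Mechanism. -/
structure MedianState (n : ℕ) (X : Type*) where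
  /-- the profiles that are still candidates for the true one -/
  candidates : Finset (Fin n → X)
  /-- the number of hard rounds so far -/
  hardRounds : ℕ
  /-- the noise on the threshold, if it was drawn since the last hard round -/
  thresholdNoise : Option ℝ

open Classical in
/-- The **Median Mechanism** for `R` queries that are `lam`-sensitive.

It keeps a set of candidate profiles, at first all of them.  Given a query `Q`, it computes the
median `med` of `Q` over the candidates and compares the error `|Q x - med|`, plus noise, to a
noisy threshold.  If the error is below the threshold, the round is easy and the answer is `med`.
If not, the round is hard: the answer is `Q x` plus noise, the candidates on the wrong side of
`med` (and those on it) are discarded, and a new noise for the threshold is drawn before the next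
comparison.  After `maxHardRounds n X` hard rounds the data are not used any more.

The coin of a round is `(ρ, ν, z)`: the noise for the threshold (used only if a new one has to be
drawn), for the comparison, and for the answer. -/
noncomputable def medianMechanism (n : ℕ) (X : Type*) [Fintype X] (ε δ lam β : ℝ) (R : ℕ) :
    OnlineMechanism n X where
  Coin := ℝ × ℝ × ℝ
  law :=
    (laplaceMeasure (4 * noiseScale n X ε δ lam)).prod
      ((laplaceMeasure (8 * noiseScale n X ε δ lam)).prod
        (laplaceMeasure (2 * noiseScale n X ε δ lam)))
  State := MedianState n X
  init := ⟨Finset.univ, 0, none⟩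
  step := fun x c s Q =>
    let med := medianOn s.candidates Q
    let ρ := s.thresholdNoise.getD c.1
    let threshold := 16 * noiseScale n X ε δ lam * Real.log (3 * R / β)
    let a := Q x + c.2.2
    if maxHardRounds n X ≤ s.hardRounds then (s, med)
    else if |Q x - med| + c.2.1 < threshold + ρ then
      (⟨s.candidates, s.hardRounds, some ρ⟩, med)
    else
      (⟨if med < a then s.candidates.filter (fun d => med < Q d)
          else s.candidates.filter (fun d => Q d < med), s.hardRounds + 1, none⟩, a)

/-! ### Games and the algorithm NRMEDIAN -/

/-- An `n`-player game with set of types `T`, in which player `i` has the set of actions `A i`.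
The action `null i` is opting out of the game, and `utility i τ a` is the payoff of player `i` if
her type is `τ` and the action profile is `a`. -/
structure Game (n : ℕ) (T : Type*) (A : Fin n → Type*) where
  null : (i : Fin n) → A i
  utility : Fin n → T → ((i : Fin n) → A i) → ℝ

/-- An online learning algorithm over a finite set of actions `B`: it maps a distribution over `B`
and a vector of (possibly noisy) losses to a new distribution over `B`. -/
abbrev LearningAlgorithm (B : Type*) [Fintype B] :=
  stdSimplex ℝ B → (B → ℝ) → stdSimplex ℝ B

namespace Game

variable {n : ℕ} {T : Type*} {A : Fin n → Type*}

/-- A game is `lam`-large if no player's action affects another player's payoff by more than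
`lam`. -/
def IsLarge (G : Game n T A) (lam : ℝ) : Prop :=
  ∀ i i' : Fin n, i ≠ i' → ∀ (τ : T) (a : (i : Fin n) → A i) (b : A i),
    |G.utility i' τ a - G.utility i' τ (Function.update a i b)| ≤ lam

/-- The indices `((i, j), τ)` of the queries of a round: a player, an action of that player and a
type. -/
abbrev LossIndex {n : ℕ} (T : Type*) (A : Fin n → Type*) := (Σ i : Fin n, A i) × T

open Classical in
/-- The mixed strategies of player `i` when she reports `r` and `Λ s ((i, j), τ)` is the loss in
round `s` of action `j` for player `i` with type `τ`.  (Rounds are counted from `0`.)  A player of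
type `τ` starts from the uniform distribution and runs her learning algorithm on the losses indexed
by `τ`; a player who reports `⊥` (here `none`) plays the null action. -/
noncomputable def strategy [∀ i, Fintype (A i)] (G : Game n T A)
    (alg : (i : Fin n) → LearningAlgorithm (A i)) (Λ : ℕ → LossIndex T A → ℝ) (i : Fin n)
    (r : Option T) : ℕ → stdSimplex ℝ (A i)
  | 0 => match r with
    | none => stdSimplex.vertex (G.null i)
    | some _ => haveI : Nonempty (A i) := ⟨G.null i⟩; stdSimplex.barycenter
  | t + 1 => match r with
    | none => stdSimplex.vertex (G.null i)
    | some τ => alg i (strategy G alg Λ i r t) (fun j => Λ t (⟨i, j⟩, τ))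

/-- The loss query of round `t` with index `((i, j), τ)`, given the losses `Λ` of the earlier
rounds: `1 - 𝔼 u(τ, (j, a₋ᵢ))`, where the actions `a i'` are drawn independently from the mixed
strategies of round `t` that the players have for the reports `x`. -/
noncomputable def lossQuery [∀ i, Fintype (A i)] (G : Game n T A)
    (alg : (i : Fin n) → LearningAlgorithm (A i)) (Λ : ℕ → LossIndex T A → ℝ) (t : ℕ)
    (w : LossIndex T A) : Query n (Option T) :=
  fun x => 1 - ∑ a : (i : Fin n) → A i,
    (∏ i' : Fin n, G.strategy alg Λ i' (x i') t (a i')) *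
      G.utility w.1.1 w.2 (Function.update a w.1.1 w.1.2)

/-- The losses recorded by a list of answers, if `m` queries are asked in every round, in the order
given by `e`. -/
def recordedLosses {m : ℕ} (e : LossIndex T A ≃ Fin m) (h : List ℝ) : ℕ → LossIndex T A → ℝ :=
  fun t w => h.getD (t * m + e w) 0

/-- The querier of the inner mechanism.  In round `t` it asks the loss queries with all the indices,
in the order given by `e`, given the noisy losses of the rounds before `t`. -/
noncomputable def querier [∀ i, Fintype (A i)] (G : Game n T A)
    (alg : (i : Fin n) → LearningAlgorithm (A i)) {m : ℕ} (e : LossIndex T A ≃ Fin m)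
    (h : List ℝ) : Query n (Option T) :=
  if hm : 0 < m then
    G.lossQuery alg (recordedLosses e h) (h.length / m)
      (e.symm ⟨h.length % m, Nat.mod_lt _ hm⟩)
  else fun _ => 0

/-- The inner mechanism NRMEDIAN-SHARED with `N` rounds: the noisy losses, which are the answers of
the query-answering mechanism `M` to all the loss queries. -/
noncomputable def nrMedianShared [∀ i, Fintype (A i)] (G : Game n T A)
    (alg : (i : Fin n) → LearningAlgorithm (A i)) {m : ℕ} (e : LossIndex T A ≃ Fin m) (N : ℕ)
    (M : OnlineMechanism n (Option T)) (x : Fin n → Option T) (ω : Fin (N * m) → M.Coin) :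
    ℕ → LossIndex T A → ℝ :=
  recordedLosses e (M.answers (G.querier alg e) x ω)

/-- The algorithm NRMEDIAN with `N` rounds: player `i` receives the sequence of the `N` mixed
strategies that she has for her own report and the noisy losses of the inner mechanism. -/
noncomputable def nrMedian [∀ i, Fintype (A i)] (G : Game n T A)
    (alg : (i : Fin n) → LearningAlgorithm (A i)) {m : ℕ} (e : LossIndex T A ≃ Fin m) (N : ℕ)
    (M : OnlineMechanism n (Option T)) (x : Fin n → Option T) (ω : Fin (N * m) → M.Coin)
    (i : Fin n) : Fin N → stdSimplex ℝ (A i) :=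
  fun t => G.strategy alg (G.nrMedianShared alg e N M x ω) i (x i) t

end Game

/-! ### The Laplace distribution -/

/-! Joint privacy reduces to privacy of the transcript. The strategies of the players other than `i`
are a measurable function of the shared noisy losses and of their own reports, which a deviation of
player `i` leaves alone. So it suffices that the loss queries are `lam`-sensitive, which follows
from largeness (`Game.lossQuery_isSensitive`), and that the query-answering mechanism is private
(`Game.nrMedian_isJointlyDifferentiallyPrivate`).

For the Median Mechanism, everything except `|Q x - med|` and `Q x` is a function of the answers
already given. Hence it is a chain of at most `c = maxHardRounds` sparse vector tests
(`SparseVector`), each of which releases two things: the index of the next hard round and a noisy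
answer. Given the past, neighbouring data change the law of either release by a factor of at most
`exp η`, where `η = lam / (2 s)` and `s` is the noise scale.

The releases are composed through Hölder's inequality. If `μ` and `ν` are within a factor `exp η` of
each other and `r = dμ/dν`, then `log r` lies in `[-η, η]` and has nonpositive mean under `ν`, so
Hoeffding's lemma bounds the `p`-th moment of `r` by `exp (p² η² / 2)`, and Hölder gives `E_μ f ≤
exp (p η² / 2) (E_ν f^q)^(1/q)` (`lintegral_le_exp_mul_lintegral_rpow`). Bounds of this shape can be
iterated (`SparseVector.value_le_moment`): the `2 c` releases give `P(B) ≤ exp (c p η²)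
P'(B)^(1/q)`. For `p = 8 log (4 / δ) / ε` the factor is `exp (ε / 4)`, and Young's inequality turns
this into `exp ε P'(B) + δ` (`exp_mul_rpow_le`). -/

lemma integral_laplace_density {b : ℝ} (hb : 0 < b) :
    ∫ z : ℝ, 1 / (2 * b) * Real.exp (-|z| / b) = 1 := by
  have h := integral_comp_abs (f := fun z : ℝ => 1 / (2 * b) * Real.exp (-z / b))
  rw [h, integral_const_mul]
  have h1 : ∀ z : ℝ, -z / b = (-b⁻¹) * z := fun z => by field_simp
  simp_rw [h1]
  rw [integral_exp_mul_Ioi (by simpa using hb)]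
  field_simp
  simp

lemma isProbabilityMeasure_laplaceMeasure {b : ℝ} (hb : 0 < b) :
    IsProbabilityMeasure (laplaceMeasure b) := by
  constructor
  have h := integral_laplace_density hb
  rw [laplaceMeasure, withDensity_apply _ MeasurableSet.univ, Measure.restrict_univ,
    ← ofReal_integral_eq_lintegral_ofReal (.of_integral_ne_zero (by rw [h]; exact one_ne_zero))
      (Filter.Eventually.of_forall fun z => by positivity), h, ENNReal.ofReal_one]

lemma lintegral_laplaceMeasure (b : ℝ) {f : ℝ → ENNReal} (hf : Measurable f) :
    ∫⁻ z, f z ∂laplaceMeasure b =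
      ∫⁻ z, ENNReal.ofReal (1 / (2 * b) * Real.exp (-|z| / b)) * f z := by
  rw [laplaceMeasure, lintegral_withDensity_eq_lintegral_mul _ (by fun_prop) hf]
  rfl

/-- Shifting Laplace noise by `t` changes expectations of nonnegative functions by a factor of at
most `exp (|t| / b)`. -/
lemma lintegral_laplaceMeasure_add_le {b : ℝ} (hb : 0 < b) (t : ℝ) {f : ℝ → ENNReal}
    (hf : Measurable f) :
    ∫⁻ z, f (z + t) ∂laplaceMeasure b ≤
      ENNReal.ofReal (Real.exp (|t| / b)) * ∫⁻ z, f z ∂laplaceMeasure b := by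
  rw [lintegral_laplaceMeasure b (by fun_prop), lintegral_laplaceMeasure b hf,
    ← lintegral_const_mul' _ _ ENNReal.ofReal_ne_top,
    ← lintegral_add_right_eq_self (μ := volume) (fun z => ENNReal.ofReal (Real.exp (|t| / b)) * _) t]
  -- After the translation by `t` both integrands contain `f (z + t)`, and only the densities at `z`
  -- and `z + t` remain to be compared.
  refine lintegral_mono fun z => ?_
  rw [← mul_assoc, ← ENNReal.ofReal_mul (by positivity)]
  refine mul_le_mul_left (ENNReal.ofReal_le_ofReal ?_) _
  have h1 : Real.exp (-|z| / b) ≤ Real.exp (|t| / b) * Real.exp (-|z + t| / b) := by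
    rw [← Real.exp_add, Real.exp_le_exp, ← add_div]
    gcongr
    have := abs_add_le z t
    have := abs_sub_abs_le_abs_sub (z + t) t
    linarith [abs_add_le z t]
  calc _ ≤ 1 / (2 * b) * (Real.exp (|t| / b) * Real.exp (-|z + t| / b)) := by gcongr
    _ = _ := by ring

lemma laplaceMeasure_map_add_le {b t η : ℝ} (hb : 0 < b) (u v : ℝ) (ht : |u - v| ≤ t)
    (hη : t / b ≤ η) :
    (laplaceMeasure b).map (fun z => u + z) ≤
      ENNReal.ofReal (Real.exp η) • (laplaceMeasure b).map (fun z => v + z) := by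
  refine Measure.le_iff.2 fun s hs => ?_
  have hm : Measurable fun z : ℝ => s.indicator (1 : ℝ → ENNReal) (v + z) :=
    (measurable_one.indicator hs).comp (measurable_const_add v)
  have h := lintegral_laplaceMeasure_add_le hb (u - v) hm
  have e1 : ∀ w : ℝ, (laplaceMeasure b).map (fun z => w + z) s =
      ∫⁻ z, s.indicator (1 : ℝ → ENNReal) (w + z) ∂laplaceMeasure b := fun w => by
    rw [← lintegral_indicator_one hs, lintegral_map (measurable_one.indicator hs)
      (measurable_const_add w)]
  rw [Measure.smul_apply, smul_eq_mul, e1, e1]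
  have e2 : ∀ z : ℝ, v + (z + (u - v)) = u + z := fun z => by ring
  simp_rw [e2] at h
  refine h.trans (mul_le_mul_left (ENNReal.ofReal_le_ofReal (Real.exp_le_exp.2 ?_)) _)
  exact (div_le_div_of_nonneg_right ht hb.le).trans hη

/-! ### Moments of the likelihood ratio of indistinguishable probability measures -/

/-- A random variable with values in `[-η, η]` and nonpositive mean has moment generating function
at most that of a Gaussian. -/
lemma integral_exp_mul_le_of_integral_nonpos {α : Type*} [MeasurableSpace α] {ν : Measure α}
    [IsProbabilityMeasure ν] {v : α → ℝ} {η p : ℝ} (hp : 0 ≤ p) (hv : Measurable v)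
    (hb : ∀ᵐ a ∂ν, v a ∈ Set.Icc (-η) η) (hm : ∫ a, v a ∂ν ≤ 0) :
    ∫ a, Real.exp (p * v a) ∂ν ≤ Real.exp (p ^ 2 * η ^ 2 / 2) := by
  -- Hoeffding's lemma for the centred variable; an interval of length `2 η` gives variance proxy `η
  -- ^ 2`.
  have h := (ProbabilityTheory.hasSubgaussianMGF_of_mem_Icc hv.aemeasurable hb).mgf_le p
  have e1 : ∀ a, Real.exp (p * v a) =
      Real.exp (p * ∫ a, v a ∂ν) * Real.exp (p * (v a - ∫ a, v a ∂ν)) := fun a => by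
    rw [← Real.exp_add]; ring_nf
  have e2 : (((‖η - -η‖₊ / 2) ^ 2 : NNReal) : ℝ) = η ^ 2 := by
    push_cast
    rw [Real.norm_eq_abs, div_pow, sq_abs]
    ring
  rw [e2] at h
  simp_rw [e1]
  rw [integral_const_mul]
  calc _ ≤ 1 * Real.exp (η ^ 2 * p ^ 2 / 2) := by
        refine mul_le_mul (Real.exp_le_one_iff.2 (mul_nonpos_of_nonneg_of_nonpos hp hm)) h
          (integral_nonneg fun _ => (Real.exp_pos _).le) zero_le_one
    _ = _ := by rw [one_mul, mul_comm (η ^ 2)]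

/-- If two probability measures are within a factor `exp η` of each other, then expectations under
the one are controlled by higher moments under the other. -/
lemma lintegral_le_exp_mul_lintegral_rpow {α : Type*} [MeasurableSpace α] {μ ν : Measure α}
    [IsProbabilityMeasure μ] [IsProbabilityMeasure ν] {η p q : ℝ} (hpq : p.HolderConjugate q)
    (h1 : μ ≤ ENNReal.ofReal (Real.exp η) • ν) (h2 : ν ≤ ENNReal.ofReal (Real.exp η) • μ)
    {f : α → ENNReal} (hf : Measurable f) :
    ∫⁻ a, f a ∂μ ≤
      ENNReal.ofReal (Real.exp (p * η ^ 2 / 2)) * (∫⁻ a, f a ^ q ∂ν) ^ (1 / q) := by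
  have hac : μ ≪ ν := Measure.absolutelyContinuous_of_le_smul h1
  set r := μ.rnDeriv ν
  have hrm : Measurable r := Measure.measurable_rnDeriv μ ν
  have hset : ∀ s, ∫⁻ a in s, r a ∂ν = μ s := fun s => Measure.setLIntegral_rnDeriv hac s
  have hup : ∀ᵐ a ∂ν, r a ≤ ENNReal.ofReal (Real.exp η) := by
    refine ae_le_of_forall_setLIntegral_le_of_sigmaFinite hrm fun s hs _ => ?_
    rw [hset, setLIntegral_const]
    simpa using h1 s
  -- The reverse domination keeps the density away from `0`, so that its logarithm is bounded.
  have hlo : ∀ᵐ a ∂ν, ENNReal.ofReal (Real.exp (-η)) ≤ r a := by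
    refine ae_le_of_forall_setLIntegral_le_of_sigmaFinite measurable_const fun s hs _ => ?_
    rw [hset, setLIntegral_const]
    have h3 : ν s ≤ ENNReal.ofReal (Real.exp η) * μ s := by simpa using h2 s
    calc _ ≤ ENNReal.ofReal (Real.exp (-η)) * (ENNReal.ofReal (Real.exp η) * μ s) := by gcongr
      _ = μ s := by
        rw [← mul_assoc, ← ENNReal.ofReal_mul (Real.exp_pos _).le, ← Real.exp_add]
        simp
  set v : α → ℝ := fun a => Real.log (r a).toReal with hvdef
  have hv : Measurable v := (Real.measurable_log).comp hrm.ennreal_toReal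
  have hpos : ∀ᵐ a ∂ν, 0 < (r a).toReal ∧ r a = ENNReal.ofReal (r a).toReal ∧
      v a ∈ Set.Icc (-η) η := by
    filter_upwards [hup, hlo] with a ha hb
    have hne : r a ≠ ⊤ := ne_top_of_le_ne_top ENNReal.ofReal_ne_top ha
    have h3 : (r a).toReal ≤ Real.exp η :=
      ENNReal.toReal_le_of_le_ofReal (Real.exp_pos _).le ha
    have h4 : Real.exp (-η) ≤ (r a).toReal := (ENNReal.ofReal_le_iff_le_toReal hne).1 hb
    have h5 := (Real.exp_pos _).trans_le h4
    exact ⟨h5, (ENNReal.ofReal_toReal hne).symm, (Real.le_log_iff_exp_le h5).2 h4,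
      (Real.log_le_iff_le_exp h5).2 h3⟩
  have hb : ∀ᵐ a ∂ν, v a ∈ Set.Icc (-η) η := hpos.mono fun a h => h.2.2
  -- The mean is minus a relative entropy: `log r ≤ r - 1`, and `r` integrates to one.
  have hmean : ∫ a, v a ∂ν ≤ 0 := by
    have hi : Integrable (fun a => (r a).toReal) ν := Measure.integrable_toReal_rnDeriv
    have hint : ∫ a, (r a).toReal ∂ν = 1 := by
      rw [Measure.integral_toReal_rnDeriv hac]; simp
    calc ∫ a, v a ∂ν ≤ ∫ a, ((r a).toReal - 1) ∂ν := by
          refine integral_mono_ae (Integrable.of_mem_Icc _ _ hv.aemeasurable hb)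
            (hi.sub (integrable_const 1)) (hpos.mono fun a h => Real.log_le_sub_one_of_pos h.1)
      _ = 0 := by rw [integral_sub hi (integrable_const 1), hint]; simp
  have hmom : ∫⁻ a, r a ^ p ∂ν ≤ ENNReal.ofReal (Real.exp (p ^ 2 * η ^ 2 / 2)) := by
    have e1 : ∫⁻ a, r a ^ p ∂ν = ∫⁻ a, ENNReal.ofReal (Real.exp (p * v a)) ∂ν := by
      refine lintegral_congr_ae (hpos.mono fun a h => ?_)
      simp only [hvdef]
      rw [h.2.1, ENNReal.ofReal_rpow_of_pos h.1, Real.rpow_def_of_pos h.1,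
        ENNReal.toReal_ofReal h.1.le, mul_comm]
    rw [e1, ← ofReal_integral_eq_lintegral_ofReal
      (ProbabilityTheory.integrable_exp_mul_of_mem_Icc hv.aemeasurable hb)
      (Filter.Eventually.of_forall fun a => (Real.exp_pos _).le)]
    exact ENNReal.ofReal_le_ofReal
      (integral_exp_mul_le_of_integral_nonpos hpq.nonneg hv hb hmean)
  calc ∫⁻ a, f a ∂μ = ∫⁻ a, (r * f) a ∂ν := (lintegral_rnDeriv_mul hac hf.aemeasurable).symm
    _ ≤ (∫⁻ a, r a ^ p ∂ν) ^ (1 / p) * (∫⁻ a, f a ^ q ∂ν) ^ (1 / q) :=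
      ENNReal.lintegral_mul_le_Lp_mul_Lq ν hpq hrm.aemeasurable hf.aemeasurable
    _ ≤ (ENNReal.ofReal (Real.exp (p ^ 2 * η ^ 2 / 2))) ^ (1 / p) *
        (∫⁻ a, f a ^ q ∂ν) ^ (1 / q) := by
      gcongr
      exact one_div_nonneg.2 hpq.nonneg
    _ = _ := by
      rw [ENNReal.ofReal_rpow_of_pos (Real.exp_pos _), ← Real.exp_mul]
      have := hpq.pos.ne'
      congr 3
      field_simp

/-- The version of `lintegral_le_exp_mul_lintegral_rpow` for distributions on a finite set. -/
lemma sum_mul_le_exp_mul_sum_rpow {ι : Type*} [Fintype ι] {u w : ι → ENNReal} {η p q : ℝ}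
    (hpq : p.HolderConjugate q) (hu : ∑ i, u i = 1) (hw : ∑ i, w i = 1)
    (h1 : ∀ i, u i ≤ ENNReal.ofReal (Real.exp η) * w i)
    (h2 : ∀ i, w i ≤ ENNReal.ofReal (Real.exp η) * u i) (f : ι → ENNReal) :
    ∑ i, u i * f i ≤
      ENNReal.ofReal (Real.exp (p * η ^ 2 / 2)) * (∑ i, w i * f i ^ q) ^ (1 / q) := by
  let _ : MeasurableSpace ι := ⊤
  set D : (ι → ENNReal) → Measure ι := fun u => ∑ i, u i • Measure.dirac i with hD
  have hap : ∀ u s, D u s = ∑ i, u i * Measure.dirac i s := fun u s => by simp [hD]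
  have hint : ∀ u g : ι → ENNReal, ∫⁻ i, g i ∂D u = ∑ i, u i * g i := fun u g => by
    simp [hD, lintegral_finsetSum_measure]
  have hle : ∀ u w : ι → ENNReal, (∀ i, u i ≤ ENNReal.ofReal (Real.exp η) * w i) →
      D u ≤ ENNReal.ofReal (Real.exp η) • D w := fun u w h => by
    refine Measure.le_iff.2 fun s _ => ?_
    rw [Measure.smul_apply, smul_eq_mul, hap, hap, Finset.mul_sum]
    refine Finset.sum_le_sum fun i _ => ?_
    rw [← mul_assoc]
    exact mul_le_mul_left (h i) _
  have : IsProbabilityMeasure (D u) := ⟨by rw [hap]; simpa using hu⟩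
  have : IsProbabilityMeasure (D w) := ⟨by rw [hap]; simpa using hw⟩
  have := lintegral_le_exp_mul_lintegral_rpow hpq (hle u w h1) (hle w u h2)
    (f := f) measurable_from_top
  rwa [hint, hint] at this

/-! ### Iterated expectations -/

/-- The expectation of `F` at the state that is reached from `s` in `t` steps, each of which uses
a fresh coin. -/
noncomputable def expectIter {S C : Type*} [MeasurableSpace C] (law : Measure C)
    (step : S → C → S) (F : S → ENNReal) : ℕ → S → ENNReal
  | 0, s => F s
  | t + 1, s => ∫⁻ c, expectIter law step F t (step s c) ∂law

lemma measurable_expectIter {S C : Type*} [MeasurableSpace S] [MeasurableSpace C]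
    {law : Measure C} [SFinite law] {step : S → C → S}
    (hstep : Measurable fun p : S × C => step p.1 p.2) {F : S → ENNReal} (hF : Measurable F)
    (t : ℕ) : Measurable (expectIter law step F t) := by
  induction t with
  | zero => exact hF
  | succ t ih => exact (ih.comp hstep).lintegral_prod_right'

lemma measurable_foldl_ofFn {S C : Type*} [MeasurableSpace S] [MeasurableSpace C]
    {step : S → C → S} (hstep : Measurable fun p : S × C => step p.1 p.2) (t : ℕ) :
    Measurable fun p : S × (Fin t → C) => (List.ofFn p.2).foldl step p.1 := by
  induction t with
  | zero => simpa using measurable_fst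
  | succ t ih =>
    simp only [List.ofFn_succ, List.foldl_cons]
    exact ih.comp ((hstep.comp (measurable_fst.prodMk
      ((measurable_pi_apply 0).comp measurable_snd))).prodMk
      (measurable_pi_lambda _ fun i => (measurable_pi_apply i.succ).comp measurable_snd))

/-- Fubini, splitting off the first coin: a product law over all rounds becomes nested integrals, on
which one can induct round by round. -/
lemma lintegral_foldl_ofFn {S C : Type*} [MeasurableSpace S] [MeasurableSpace C]
    {law : Measure C} [IsProbabilityMeasure law] {step : S → C → S}
    (hstep : Measurable fun p : S × C => step p.1 p.2) {F : S → ENNReal} (hF : Measurable F)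
    (t : ℕ) (s : S) :
    ∫⁻ ω, F ((List.ofFn ω).foldl step s) ∂(Measure.pi fun _ : Fin t => law) =
      expectIter law step F t s := by
  induction t generalizing s with
  | zero => simp [expectIter]
  | succ t ih =>
    have hmp := (measurePreserving_piFinSuccAbove (fun _ : Fin (t + 1) => law) 0).symm
    have hm : ∀ k, Measurable fun p : S × (Fin k → C) => F ((List.ofFn p.2).foldl step p.1) :=
      fun k => hF.comp (measurable_foldl_ofFn hstep k)
    have hms : Measurable fun ω : Fin (t + 1) → C => F ((List.ofFn ω).foldl step s) :=
      (hm (t + 1)).comp measurable_prodMk_left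
    rw [← hmp.lintegral_comp hms]
    have e1 : ∀ p : C × (Fin t → C), (List.ofFn ((MeasurableEquiv.piFinSuccAbove
        (fun _ : Fin (t + 1) => C) 0).symm p)).foldl step s =
        (List.ofFn p.2).foldl step (step s p.1) := fun p => by
      simp [List.ofFn_succ, MeasurableEquiv.piFinSuccAbove, Fin.insertNthEquiv]
    simp only [e1]
    have hmF : Measurable fun p : C × (Fin t → C) => F ((List.ofFn p.2).foldl step (step s p.1)) :=
      (hm t).comp ((hstep.comp (measurable_const.prodMk measurable_fst)).prodMk measurable_snd)
    rw [lintegral_prod _ hmF.aemeasurable]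
    simp only [expectIter]
    exact lintegral_congr fun c => ih _

/-! ### The index of the first hard round -/

/-- The probability that noise of law `N` fails the tests `b 0, …, b (j - 1)` against the threshold
`ρ` and passes the test `b j`, if `j < t`; if `j = t`, that it fails the first `t` tests. -/
noncomputable def stopWeight (N : Measure ℝ) (b : ℕ → ℝ) (t : ℕ) (ρ : ℝ) (j : ℕ) : ENNReal :=
  (∏ l ∈ Finset.range j, N (Set.Iio (ρ - b l))) * if j < t then N (Set.Ici (ρ - b j)) else 1

lemma stopWeight_succ_zero (N : Measure ℝ) (b : ℕ → ℝ) (t : ℕ) (ρ : ℝ) :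
    stopWeight N b (t + 1) ρ 0 = N (Set.Ici (ρ - b 0)) := by
  simp [stopWeight]

lemma stopWeight_succ_succ (N : Measure ℝ) (b : ℕ → ℝ) (t : ℕ) (ρ : ℝ) (j : ℕ) :
    stopWeight N b (t + 1) ρ (j + 1) =
      N (Set.Iio (ρ - b 0)) * stopWeight N (fun l => b (l + 1)) t ρ j := by
  simp only [stopWeight, Finset.prod_range_succ', Nat.add_lt_add_iff_right]
  ring

lemma measure_Iio_add_measure_Ici (N : Measure ℝ) [IsProbabilityMeasure N] (u : ℝ) :
    N (Set.Iio u) + N (Set.Ici u) = 1 := by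
  rw [← Set.compl_Iio, measure_add_measure_compl measurableSet_Iio, measure_univ]

lemma sum_stopWeight (N : Measure ℝ) [IsProbabilityMeasure N] (b : ℕ → ℝ) (t : ℕ) (ρ : ℝ) :
    ∑ j ∈ Finset.range (t + 1), stopWeight N b t ρ j = 1 := by
  induction t generalizing b with
  | zero => simp [stopWeight]
  | succ t ih =>
    rw [Finset.sum_range_succ', stopWeight_succ_zero]
    simp_rw [stopWeight_succ_succ]
    rw [← Finset.mul_sum, ih, mul_one, measure_Iio_add_measure_Ici]

lemma measurable_stopWeight (N : Measure ℝ) (b : ℕ → ℝ) (t j : ℕ) :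
    Measurable fun ρ => stopWeight N b t ρ j := by
  -- Each factor is monotone or antitone in the threshold.
  have h1 : ∀ v : ℝ, Measurable fun ρ : ℝ => N (Set.Iio (ρ - v)) := fun v =>
    Monotone.measurable fun ρ ρ' h => measure_mono (Set.Iio_subset_Iio (by linarith))
  have h2 : ∀ v : ℝ, Measurable fun ρ : ℝ => N (Set.Ici (ρ - v)) := fun v =>
    Antitone.measurable fun ρ ρ' h => measure_mono (Set.Ici_subset_Ici.2 (by linarith))
  refine Measurable.mul (Finset.measurable_prod _ fun l _ => h1 (b l)) ?_
  split_ifs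
  · exact h2 _
  · exact measurable_const

/-- Raising the threshold by `lam` compensates for the change of data in every failed test at no
cost, however many there are. Only the one test that is passed must be paid for, by shifting its
noise by `2 * lam`. -/
lemma stopWeight_laplace_le {B lam : ℝ} (hB : 0 < B) (hlam : 0 ≤ lam) {b b' : ℕ → ℝ}
    (hb : ∀ l, |b l - b' l| ≤ lam) (t : ℕ) (ρ : ℝ) (j : ℕ) :
    stopWeight (laplaceMeasure B) b t ρ j ≤ ENNReal.ofReal (Real.exp (2 * lam / B)) *
      stopWeight (laplaceMeasure B) b' t (ρ + lam) j := by
  rw [stopWeight, stopWeight, mul_left_comm]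
  refine mul_le_mul' (Finset.prod_le_prod' fun l _ => measure_mono (Set.Iio_subset_Iio ?_)) ?_
  · linarith [(abs_le.1 (hb l)).1]
  split_ifs with h
  · have h1 := lintegral_laplaceMeasure_add_le hB (2 * lam)
      (measurable_one.indicator (measurableSet_Ici (a := ρ - b j + 2 * lam)) : Measurable
        ((Set.Ici (ρ - b j + 2 * lam)).indicator (1 : ℝ → ENNReal)))
    rw [lintegral_indicator_one measurableSet_Ici, abs_of_nonneg (by positivity)] at h1
    have e : ∀ z : ℝ, (Set.Ici (ρ - b j + 2 * lam)).indicator (1 : ℝ → ENNReal) (z + 2 * lam) =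
        (Set.Ici (ρ - b j)).indicator 1 z := fun z => by
      simp [Set.indicator_apply]
    simp_rw [e] at h1
    rw [lintegral_indicator_one measurableSet_Ici] at h1
    refine h1.trans (mul_le_mul_right (measure_mono (Set.Ici_subset_Ici.2 ?_)) _)
    linarith [(abs_le.1 (hb j)).2]
  · rw [mul_one, ← ENNReal.ofReal_one]
    exact ENNReal.ofReal_le_ofReal (Real.one_le_exp (by positivity))

/-- The law of the index of the first hard round hardly depends on the data. -/
lemma lintegral_stopWeight_le {s lam : ℝ} (hs : 0 < s) (hlam : 0 ≤ lam) {b b' : ℕ → ℝ}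
    (hb : ∀ l, |b l - b' l| ≤ lam) (t j : ℕ) :
    ∫⁻ ρ, stopWeight (laplaceMeasure (8 * s)) b t ρ j ∂laplaceMeasure (4 * s) ≤
      ENNReal.ofReal (Real.exp (lam / (2 * s))) *
        ∫⁻ ρ, stopWeight (laplaceMeasure (8 * s)) b' t ρ j ∂laplaceMeasure (4 * s) := by
  have h8 : 0 < 8 * s := by positivity
  have h4 : 0 < 4 * s := by positivity
  -- The passed test costs `2 lam / (8 s)` in the exponent, and shifting the threshold back costs
  -- `lam / (4 s)`; together `lam / (2 s)`.
  calc _ ≤ ∫⁻ ρ, ENNReal.ofReal (Real.exp (2 * lam / (8 * s))) *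
        stopWeight (laplaceMeasure (8 * s)) b' t (ρ + lam) j ∂laplaceMeasure (4 * s) :=
        lintegral_mono fun ρ => stopWeight_laplace_le h8 hlam hb t ρ j
    _ ≤ ENNReal.ofReal (Real.exp (2 * lam / (8 * s))) *
        (ENNReal.ofReal (Real.exp (|lam| / (4 * s))) * ∫⁻ ρ,
          stopWeight (laplaceMeasure (8 * s)) b' t ρ j ∂laplaceMeasure (4 * s)) := by
      rw [lintegral_const_mul' _ _ ENNReal.ofReal_ne_top]
      gcongr
      exact lintegral_laplaceMeasure_add_le h4 lam (measurable_stopWeight _ _ _ _)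
    _ = _ := by
      rw [← mul_assoc, ← ENNReal.ofReal_mul (Real.exp_pos _).le, ← Real.exp_add,
        abs_of_nonneg hlam]
      congr 4
      field_simp
      ring

/-! ### Sequences of sparse vector tests -/

/-- The part of the sparse vector technique that does not depend on the private data: how the
public state changes in easy rounds, and in hard rounds that release a number, and how many hard
rounds there were.  After `cap` hard rounds all rounds are easy. -/
structure SparseVector (Γ : Type*) [MeasurableSpace Γ] where
  easy : Γ → Γ
  hard : Γ → ℝ → Γ
  rank : Γ → ℕ
  cap : ℕ
  measurable_easy : Measurable easy
  measurable_hard : Measurable fun p : Γ × ℝ => hard p.1 p.2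
  measurable_rank : Measurable rank
  rank_easy : ∀ γ, rank (easy γ) = rank γ
  rank_hard : ∀ γ a, rank (hard γ a) = rank γ + 1

namespace SparseVector

variable {Γ : Type*} [MeasurableSpace Γ]

/-- One round with private data given by the levels `g` that are tested and the numbers `m` that are
released with noise.  The state consists of the public state, of a flag that tells whether the
threshold was already drawn, and of the threshold. -/
noncomputable def step (D : SparseVector Γ) (g m : Γ → ℝ) (p : Γ × Bool × ℝ) (c : ℝ × ℝ × ℝ) :
    Γ × Bool × ℝ :=
  if D.cap ≤ D.rank p.1 then (D.easy p.1, p.2)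
  else if g p.1 + c.2.1 < bif p.2.1 then p.2.2 else c.1 then
    (D.easy p.1, true, bif p.2.1 then p.2.2 else c.1)
  else (D.hard p.1 (m p.1 + c.2.2), false, 0)

lemma measurable_step (D : SparseVector Γ) {g m : Γ → ℝ} (hg : Measurable g) (hm : Measurable m) :
    Measurable fun p : (Γ × Bool × ℝ) × (ℝ × ℝ × ℝ) => D.step g m p.1 p.2 := by
  have hρ : Measurable fun p : (Γ × Bool × ℝ) × (ℝ × ℝ × ℝ) =>
      bif p.1.2.1 then p.1.2.2 else p.2.1 := by
    simp only [Bool.cond_eq_ite]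
    exact Measurable.ite (measurableSet_eq_fun (by fun_prop) measurable_const) (by fun_prop)
      (by fun_prop)
  refine Measurable.ite ?_ ?_ (Measurable.ite ?_ ?_ ?_)
  · exact measurableSet_le measurable_const (D.measurable_rank.comp (by fun_prop))
  · exact (D.measurable_easy.comp (by fun_prop)).prodMk (by fun_prop)
  · exact measurableSet_lt ((hg.comp (by fun_prop)).add (by fun_prop)) hρ
  · exact (D.measurable_easy.comp (by fun_prop)).prodMk (measurable_const.prodMk hρ)
  · exact (D.measurable_hard.comp ((measurable_fst.comp measurable_fst).prodMk
      ((hm.comp (by fun_prop)).add (by fun_prop)))).prodMk measurable_const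

/-- The law of the coins of a round. -/
noncomputable def coinLaw (s : ℝ) : Measure (ℝ × ℝ × ℝ) :=
  (laplaceMeasure (4 * s)).prod ((laplaceMeasure (8 * s)).prod (laplaceMeasure (2 * s)))

lemma isProbabilityMeasure_coinLaw {s : ℝ} (hs : 0 < s) : IsProbabilityMeasure (coinLaw s) := by
  have := isProbabilityMeasure_laplaceMeasure (show 0 < 4 * s by positivity)
  have := isProbabilityMeasure_laplaceMeasure (show 0 < 8 * s by positivity)
  have := isProbabilityMeasure_laplaceMeasure (show 0 < 2 * s by positivity)
  unfold coinLaw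
  infer_instance

/-- The expectation of a function `F` of the public state after `t` rounds. -/
noncomputable def value (D : SparseVector Γ) (s : ℝ) (g m : Γ → ℝ) (F : Γ → ENNReal) (t : ℕ)
    (p : Γ × Bool × ℝ) : ENNReal :=
  expectIter (coinLaw s) (D.step g m) (fun p => F p.1) t p

/-- The expectation of a function `F` of the public state after `t` rounds and a hard one before
them. -/
noncomputable def hardValue (D : SparseVector Γ) (s : ℝ) (g m : Γ → ℝ) (F : Γ → ENNReal) (t : ℕ)
    (γ : Γ) : ENNReal :=
  ∫⁻ z, D.value s g m F t (D.hard γ (m γ + z), false, 0) ∂laplaceMeasure (2 * s)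

section

variable (D : SparseVector Γ) {s : ℝ} {g m : Γ → ℝ} {F : Γ → ENNReal}

lemma measurable_value (hs : 0 < s) (hg : Measurable g) (hm : Measurable m) (hF : Measurable F)
    (t : ℕ) : Measurable (D.value s g m F t) := by
  have := isProbabilityMeasure_coinLaw hs
  exact measurable_expectIter (D.measurable_step hg hm) (hF.comp measurable_fst) t

lemma rank_iterate_easy (γ : Γ) (j : ℕ) : D.rank (D.easy^[j] γ) = D.rank γ := by
  induction j generalizing γ with
  | zero => rfl
  | succ j ih => rw [Function.iterate_succ_apply, ih, D.rank_easy]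

/-- Past the cap neither data nor coins matter, so the values for neighbouring data coincide. -/
lemma value_of_cap_le (hs : 0 < s) (t : ℕ) {γ : Γ} (h : D.cap ≤ D.rank γ) (b : Bool × ℝ) :
    D.value s g m F t (γ, b) = F (D.easy^[t] γ) := by
  have := isProbabilityMeasure_coinLaw hs
  unfold value
  induction t generalizing γ with
  | zero => rfl
  | succ t ih =>
    have e : ∀ c, D.step g m (γ, b) c = (D.easy γ, b) := fun c => if_pos h
    simp only [expectIter, e]
    rw [ih (by rwa [D.rank_easy]), lintegral_const, measure_univ, mul_one,
      Function.iterate_succ_apply]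

/-- Conditioning on the comparison noise. The coin for the threshold is ignored, and the answer
noise enters only if the round is hard. -/
lemma value_succ_true (hs : 0 < s) (hg : Measurable g) (hm : Measurable m) (hF : Measurable F)
    (t : ℕ) {γ : Γ} (h : D.rank γ < D.cap) (ρ : ℝ) :
    D.value s g m F (t + 1) (γ, true, ρ) =
      laplaceMeasure (8 * s) (Set.Iio (ρ - g γ)) * D.value s g m F t (D.easy γ, true, ρ) +
      laplaceMeasure (8 * s) (Set.Ici (ρ - g γ)) * D.hardValue s g m F t γ := by
  have := isProbabilityMeasure_laplaceMeasure (show 0 < 4 * s by positivity)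
  have := isProbabilityMeasure_laplaceMeasure (show 0 < 8 * s by positivity)
  have := isProbabilityMeasure_laplaceMeasure (show 0 < 2 * s by positivity)
  have hV := D.measurable_value hs hg hm hF t
  have hmeas : Measurable fun c : ℝ × ℝ × ℝ => D.value s g m F t (D.step g m (γ, true, ρ) c) :=
    hV.comp ((D.measurable_step hg hm).comp measurable_prodMk_left)
  have e : ∀ ρ' ν z : ℝ, D.value s g m F t (D.step g m (γ, true, ρ) (ρ', ν, z)) =
      (Set.Iio (ρ - g γ)).indicator (fun _ => D.value s g m F t (D.easy γ, true, ρ)) ν +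
      (Set.Ici (ρ - g γ)).indicator
        (fun _ => D.value s g m F t (D.hard γ (m γ + z), false, 0)) ν := fun ρ' ν z => by
    by_cases hν : ν < ρ - g γ
    · have h1 : g γ + ν < ρ := by linarith
      have h2 : ν ∉ Set.Ici (ρ - g γ) := not_le.2 hν
      simp [step, not_le.2 h, hν, h1, Set.indicator_of_notMem h2]
    · have h1 : ¬ g γ + ν < ρ := by linarith
      simp [step, not_le.2 h, hν, h1, not_lt.1 hν]
  change ∫⁻ c, D.value s g m F t (D.step g m (γ, true, ρ) c) ∂coinLaw s = _
  rw [coinLaw, lintegral_prod _ hmeas.aemeasurable]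
  have e2 : ∀ ρ' : ℝ, ∫⁻ c, D.value s g m F t (D.step g m (γ, true, ρ) (ρ', c))
      ∂(laplaceMeasure (8 * s)).prod (laplaceMeasure (2 * s)) =
      laplaceMeasure (8 * s) (Set.Iio (ρ - g γ)) * D.value s g m F t (D.easy γ, true, ρ) +
      laplaceMeasure (8 * s) (Set.Ici (ρ - g γ)) * D.hardValue s g m F t γ := fun ρ' => by
    have hmeas' : Measurable fun c : ℝ × ℝ =>
        D.value s g m F t (D.step g m (γ, true, ρ) (ρ', c)) := hmeas.comp measurable_prodMk_left
    rw [lintegral_prod _ hmeas'.aemeasurable]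
    simp only [e]
    have e3 : ∀ ν : ℝ, ∫⁻ z, ((Set.Iio (ρ - g γ)).indicator
        (fun _ => D.value s g m F t (D.easy γ, true, ρ)) ν +
        (Set.Ici (ρ - g γ)).indicator
          (fun _ => D.value s g m F t (D.hard γ (m γ + z), false, 0)) ν)
          ∂laplaceMeasure (2 * s) =
        (Set.Iio (ρ - g γ)).indicator (fun _ => D.value s g m F t (D.easy γ, true, ρ)) ν +
        (Set.Ici (ρ - g γ)).indicator (fun _ => D.hardValue s g m F t γ) ν := fun ν => by
      rw [lintegral_add_left measurable_const, lintegral_const, measure_univ, mul_one]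
      congr 1
      by_cases hν : ν ∈ Set.Ici (ρ - g γ)
      · simp only [Set.indicator_of_mem hν, hardValue]
      · simp only [Set.indicator_of_notMem hν, lintegral_zero]
    simp only [e3]
    rw [lintegral_add_left (measurable_const.indicator measurableSet_Iio),
      lintegral_indicator_const measurableSet_Iio, lintegral_indicator_const measurableSet_Ici,
      mul_comm, mul_comm (D.hardValue s g m F t γ)]
  simp only [e2]
  rw [lintegral_const, measure_univ, mul_one]

/-- A threshold drawn lazily in the next round may as well be drawn in advance. For a fixed
threshold the tests then use independent noise. -/
lemma value_false (hs : 0 < s) (hg : Measurable g) (hm : Measurable m) (hF : Measurable F)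
    (t : ℕ) {γ : Γ} (h : D.rank γ < D.cap) :
    D.value s g m F t (γ, false, 0) =
      ∫⁻ ρ, D.value s g m F t (γ, true, ρ) ∂laplaceMeasure (4 * s) := by
  have := isProbabilityMeasure_laplaceMeasure (show 0 < 4 * s by positivity)
  have := isProbabilityMeasure_laplaceMeasure (show 0 < 8 * s by positivity)
  have := isProbabilityMeasure_laplaceMeasure (show 0 < 2 * s by positivity)
  cases t with
  | zero => simp [value, expectIter]
  | succ t =>
    have hmeas : ∀ b, Measurable fun c : ℝ × ℝ × ℝ => D.value s g m F t (D.step g m (γ, b) c) :=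
      fun b => (D.measurable_value hs hg hm hF t).comp
        ((D.measurable_step hg hm).comp measurable_prodMk_left)
    change ∫⁻ c, D.value s g m F t (D.step g m (γ, false, 0) c) ∂coinLaw s =
      ∫⁻ ρ, ∫⁻ c, D.value s g m F t (D.step g m (γ, true, ρ) c) ∂coinLaw s ∂_
    rw [coinLaw, lintegral_prod _ (hmeas _).aemeasurable]
    refine lintegral_congr fun ρ => ?_
    rw [lintegral_prod _ (hmeas _).aemeasurable]
    have e : ∀ (ρ' : ℝ) (c : ℝ × ℝ), D.step g m (γ, true, ρ) (ρ', c) =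
        D.step g m (γ, false, 0) (ρ, c) := fun _ _ => by
      simp [step, not_le.2 h]
    simp only [e]
    rw [lintegral_const, measure_univ, mul_one]

/-- The conditional expectation of `F` after `t` rounds, given that `j` of them are easy and the
next one, if there is one, is hard. -/
noncomputable def stopValue (s : ℝ) (g m : Γ → ℝ) (F : Γ → ENNReal) (t : ℕ) (γ : Γ) (j : ℕ) :
    ENNReal :=
  if j < t then D.hardValue s g m F (t - 1 - j) (D.easy^[j] γ) else F (D.easy^[j] γ)

/-- Decomposition according to the first hard round. That round discards the threshold, so the
conditional values do not depend on `ρ`, and averaging over `ρ` later affects the weights alone. -/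
lemma value_true_eq_sum (hs : 0 < s) (hg : Measurable g) (hm : Measurable m) (hF : Measurable F)
    (t : ℕ) {γ : Γ} (h : D.rank γ < D.cap) (ρ : ℝ) :
    D.value s g m F t (γ, true, ρ) = ∑ j ∈ Finset.range (t + 1),
      stopWeight (laplaceMeasure (8 * s)) (fun l => g (D.easy^[l] γ)) t ρ j *
        D.stopValue s g m F t γ j := by
  induction t generalizing γ with
  | zero => simp [stopWeight, stopValue, value, expectIter]
  | succ t ih =>
    rw [D.value_succ_true hs hg hm hF t h, ih (by rwa [D.rank_easy]), Finset.mul_sum,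
      Finset.sum_range_succ' _ (t + 1), stopWeight_succ_zero]
    congr 1
    · refine Finset.sum_congr rfl fun j _ => ?_
      rw [stopWeight_succ_succ, mul_assoc]
      simp [stopValue, Nat.sub_sub, add_comm]

lemma value_false_eq_sum (hs : 0 < s) (hg : Measurable g) (hm : Measurable m) (hF : Measurable F)
    (t : ℕ) {γ : Γ} (h : D.rank γ < D.cap) :
    D.value s g m F t (γ, false, 0) = ∑ j : Fin (t + 1),
      (∫⁻ ρ, stopWeight (laplaceMeasure (8 * s)) (fun l => g (D.easy^[l] γ)) t ρ j
        ∂laplaceMeasure (4 * s)) * D.stopValue s g m F t γ j := by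
  rw [D.value_false hs hg hm hF t h, ← Finset.sum_range fun j =>
      (∫⁻ ρ, stopWeight (laplaceMeasure (8 * s)) (fun l => g (D.easy^[l] γ)) t ρ j
        ∂laplaceMeasure (4 * s)) * D.stopValue s g m F t γ j]
  simp_rw [D.value_true_eq_sum hs hg hm hF t h]
  rw [lintegral_finsetSum _ fun j _ => (measurable_stopWeight _ _ _ _).mul_const _]
  exact Finset.sum_congr rfl fun j _ => lintegral_mul_const _ (measurable_stopWeight _ _ _ _)

end

lemma sum_lintegral_stopWeight {s : ℝ} (hs : 0 < s) (b : ℕ → ℝ) (t : ℕ) :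
    ∑ j : Fin (t + 1), ∫⁻ ρ, stopWeight (laplaceMeasure (8 * s)) b t ρ j
      ∂laplaceMeasure (4 * s) = 1 := by
  have := isProbabilityMeasure_laplaceMeasure (show 0 < 4 * s by positivity)
  have := isProbabilityMeasure_laplaceMeasure (show 0 < 8 * s by positivity)
  rw [← lintegral_finsetSum _ fun j _ => measurable_stopWeight _ _ _ _]
  have e : ∀ ρ, ∑ j : Fin (t + 1), stopWeight (laplaceMeasure (8 * s)) b t ρ j = 1 := fun ρ => by
    rw [← sum_stopWeight (laplaceMeasure (8 * s)) b t ρ, Finset.sum_range]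
  simp only [e]
  rw [lintegral_const, measure_univ, mul_one]

/-- The factor by which a hard round, and likewise the easy rounds before it, can increase
expectations. -/
noncomputable def momentFactor (s lam p : ℝ) : ENNReal :=
  ENNReal.ofReal (Real.exp (p * (lam / (2 * s)) ^ 2 / 2))

lemma one_le_momentFactor {s lam p : ℝ} (hp : 0 ≤ p) : 1 ≤ momentFactor s lam p := by
  rw [momentFactor, ← ENNReal.ofReal_one]
  exact ENNReal.ofReal_le_ofReal (Real.one_le_exp (by positivity))

/-- The moment bound for the first release, the index of the hard round: its laws under the two data
are close distributions on `Fin (t + 1)`, and `κ` collects the loss of all that follows. -/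
lemma value_le_moment_of_stopValue_le (D : SparseVector Γ) {s lam p q : ℝ} (hs : 0 < s)
    (hlam : 0 ≤ lam) (hpq : p.HolderConjugate q) {g m g' m' : Γ → ℝ} (hg : Measurable g)
    (hm : Measurable m) (hg' : Measurable g') (hm' : Measurable m')
    (hgg : ∀ γ, |g γ - g' γ| ≤ lam) {F : Γ → ENNReal} (hF : Measurable F) {κ : ENNReal} (t : ℕ)
    {γ : Γ} (h : D.rank γ < D.cap)
    (hle : ∀ j, D.stopValue s g m F t γ j ≤
      κ * D.stopValue s g' m' (fun γ => F γ ^ q) t γ j ^ (1 / q)) :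
    D.value s g m F t (γ, false, 0) ≤ momentFactor s lam p * κ *
      D.value s g' m' (fun γ => F γ ^ q) t (γ, false, 0) ^ (1 / q) := by
  have hq := hpq.symm.pos
  rw [D.value_false_eq_sum hs hg hm hF t h,
    D.value_false_eq_sum hs hg' hm' (hF.pow_const q) t h]
  set f : Fin (t + 1) → ENNReal := fun j =>
    D.stopValue s g' m' (fun γ => F γ ^ q) t γ j ^ (1 / q) with hf
  have hfq : ∀ j : Fin (t + 1), D.stopValue s g' m' (fun γ => F γ ^ q) t γ j = f j ^ q := fun j => by
    rw [hf, ← ENNReal.rpow_mul, one_div_mul_cancel hq.ne', ENNReal.rpow_one]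
  simp_rw [hfq]
  have hgg' : ∀ γ, |g' γ - g γ| ≤ lam := fun γ => by rw [abs_sub_comm]; exact hgg γ
  have := sum_mul_le_exp_mul_sum_rpow hpq
    (sum_lintegral_stopWeight hs (fun l => g (D.easy^[l] γ)) t)
    (sum_lintegral_stopWeight hs (fun l => g' (D.easy^[l] γ)) t)
    (fun j => lintegral_stopWeight_le hs hlam (fun l => hgg _) t j)
    (fun j => lintegral_stopWeight_le hs hlam (fun l => hgg' _) t j) f
  calc _ ≤ ∑ j : Fin (t + 1), κ * ((∫⁻ ρ, stopWeight (laplaceMeasure (8 * s))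
        (fun l => g (D.easy^[l] γ)) t ρ j ∂laplaceMeasure (4 * s)) * f j) := by
        refine Finset.sum_le_sum fun j _ => ?_
        rw [mul_left_comm]
        exact mul_le_mul_right (hle j) _
    _ ≤ κ * (momentFactor s lam p * _) := by
        rw [← Finset.mul_sum]
        exact mul_le_mul_right this κ
    _ = _ := by rw [← mul_assoc, mul_comm κ]

/-- The moment bound for the second release. The two answer laws are translates of Laplace noise of
scale `2 * s`, again at cost `lam / (2 * s)`. The hypothesis compares both data at the same released
`a`, since the next public state depends on the data only through `a`. -/
lemma hardValue_le_moment_of_value_le (D : SparseVector Γ) {s lam p q : ℝ} (hs : 0 < s)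
    (hpq : p.HolderConjugate q) {g m g' m' : Γ → ℝ} (hg' : Measurable g') (hm' : Measurable m')
    (hmm : ∀ γ, |m γ - m' γ| ≤ lam) {F : Γ → ENNReal} (hF : Measurable F) {κ : ENNReal} (t : ℕ)
    (γ : Γ)
    (hval : ∀ a, D.value s g m F t (D.hard γ a, false, 0) ≤
      κ * D.value s g' m' (fun γ => F γ ^ q) t (D.hard γ a, false, 0) ^ (1 / q)) :
    D.hardValue s g m F t γ ≤ κ * (momentFactor s lam p *
      D.hardValue s g' m' (fun γ => F γ ^ q) t γ ^ (1 / q)) := by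
  have hq := hpq.symm.pos
  have h2 : 0 < 2 * s := by positivity
  have := isProbabilityMeasure_laplaceMeasure h2
  set f : ℝ → ENNReal := fun a =>
    D.value s g' m' (fun γ => F γ ^ q) t (D.hard γ a, false, 0) ^ (1 / q) with hf
  have hfm : Measurable f := ((D.measurable_value hs hg' hm' (hF.pow_const q) t).comp
    ((D.measurable_hard.comp measurable_prodMk_left).prodMk measurable_const)).pow_const _
  have hfq : ∀ a, D.value s g' m' (fun γ => F γ ^ q) t (D.hard γ a, false, 0) = f a ^ q :=
    fun a => by rw [hf, ← ENNReal.rpow_mul, one_div_mul_cancel hq.ne', ENNReal.rpow_one]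
  have hP : ∀ u : ℝ, IsProbabilityMeasure ((laplaceMeasure (2 * s)).map fun z => u + z) :=
    fun u => Measure.isProbabilityMeasure_map (measurable_const_add u).aemeasurable
  have hmm' : |m' γ - m γ| ≤ lam := by rw [abs_sub_comm]; exact hmm γ
  have key := lintegral_le_exp_mul_lintegral_rpow hpq
    (laplaceMeasure_map_add_le h2 (m γ) (m' γ) (hmm γ) le_rfl)
    (laplaceMeasure_map_add_le h2 (m' γ) (m γ) hmm' le_rfl) hfm
  rw [lintegral_map hfm (measurable_const_add _),
    lintegral_map (hfm.pow_const q) (measurable_const_add _)] at key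
  unfold hardValue
  simp_rw [hfq]
  calc _ ≤ ∫⁻ z, κ * f (m γ + z) ∂laplaceMeasure (2 * s) := lintegral_mono fun z => hval _
    _ = κ * ∫⁻ z, f (m γ + z) ∂laplaceMeasure (2 * s) :=
      lintegral_const_mul _ (hfm.comp (measurable_const_add _))
    _ ≤ _ := mul_le_mul_right key κ

/-- **Composition**: with at most `k` hard rounds to come, expectations for some data are controlled
by higher moments for neighboring data. -/
theorem value_le_moment (D : SparseVector Γ) {s lam p q : ℝ} (hs : 0 < s) (hlam : 0 ≤ lam)
    (hpq : p.HolderConjugate q) {g m g' m' : Γ → ℝ} (hg : Measurable g) (hm : Measurable m)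
    (hg' : Measurable g') (hm' : Measurable m') (hgg : ∀ γ, |g γ - g' γ| ≤ lam)
    (hmm : ∀ γ, |m γ - m' γ| ≤ lam) {F : Γ → ENNReal} (hF : Measurable F) (k : ℕ) {γ : Γ}
    (hk : D.cap ≤ D.rank γ + k) (t : ℕ) :
    D.value s g m F t (γ, false, 0) ≤ (momentFactor s lam p ^ 2) ^ k *
      D.value s g' m' (fun γ => F γ ^ q) t (γ, false, 0) ^ (1 / q) := by
  have hq := hpq.symm.pos
  have hone : 1 ≤ momentFactor s lam p := one_le_momentFactor hpq.nonneg
  have hroot : ∀ γ, F γ = (F γ ^ q) ^ (1 / q) := fun γ => by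
    rw [← ENNReal.rpow_mul, mul_one_div_cancel hq.ne', ENNReal.rpow_one]
  have hhalt : ∀ (k t : ℕ) {γ : Γ}, D.cap ≤ D.rank γ → D.value s g m F t (γ, false, 0) ≤
      (momentFactor s lam p ^ 2) ^ k *
        D.value s g' m' (fun γ => F γ ^ q) t (γ, false, 0) ^ (1 / q) := fun k t γ h => by
    rw [D.value_of_cap_le hs t h, D.value_of_cap_le hs t h, ← hroot]
    exact le_mul_of_one_le_left' (one_le_pow₀ (one_le_pow₀ hone))
  induction k generalizing γ t with
  | zero => exact hhalt 0 t hk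
  | succ k ih =>
    rcases le_or_gt D.cap (D.rank γ) with h | h
    · exact hhalt _ t h
    -- One factor pays for the index of the hard round, one for its answer, and the rest for the
    -- later hard rounds.
    have e : (momentFactor s lam p ^ 2) ^ (k + 1) =
        momentFactor s lam p * ((momentFactor s lam p ^ 2) ^ k * momentFactor s lam p) := by ring
    rw [e]
    refine D.value_le_moment_of_stopValue_le hs hlam hpq hg hm hg' hm' hgg hF t h fun j => ?_
    unfold stopValue
    split_ifs
    · rw [mul_assoc]
      refine D.hardValue_le_moment_of_value_le hs hpq hg' hm' hmm hF _ _ fun a => ih ?_ _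
      -- The hard round raises the rank by one, so `k` more suffice.
      rw [D.rank_hard, D.rank_iterate_easy]; omega
    · rw [← hroot]
      exact le_mul_of_one_le_left' (one_le_mul (one_le_pow₀ (one_le_pow₀ hone)) hone)

end SparseVector

/-! ### Measurability of the median -/

/-- The infimum is attained: the count changes only at values of `Q`, so if it is too small at `t`,
no `m` below the next larger value is admissible. This expresses sublevel sets of the median by
finite counts. -/
lemma medianOn_le_iff {D : Type*} {S : Finset D} (hS : S.Nonempty) (Q : D → ℝ) (t : ℝ) :
    medianOn S Q ≤ t ↔ S.card ≤ 2 * (S.filter fun d => Q d ≤ t).card := by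
  obtain ⟨dmin, -, hmin⟩ := S.exists_min_image Q hS
  obtain ⟨dmax, -, hmax⟩ := S.exists_max_image Q hS
  have hbdd : BddBelow {m : ℝ | S.card ≤ 2 * (S.filter fun d => Q d ≤ m).card} := by
    refine ⟨Q dmin, fun m hm => ?_⟩
    have hpos : 0 < (S.filter fun d => Q d ≤ m).card := by
      have h1 := hS.card_pos
      simp only [Set.mem_ofPred_eq] at hm
      omega
    obtain ⟨d, hd⟩ := Finset.card_pos.1 hpos
    rw [Finset.mem_filter] at hd
    exact (hmin d hd.1).trans hd.2
  have hne : {m : ℝ | S.card ≤ 2 * (S.filter fun d => Q d ≤ m).card}.Nonempty := by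
    refine ⟨Q dmax, ?_⟩
    rw [Set.mem_ofPred_eq, Finset.filter_true_of_mem hmax]
    omega
  refine ⟨fun h => ?_, fun h => csInf_le hbdd h⟩
  by_contra hcon
  have hU : (S.filter fun d => ¬ Q d ≤ t).Nonempty := by
    rw [Finset.nonempty_iff_ne_empty]
    intro he
    rw [Finset.filter_eq_empty_iff] at he
    rw [Finset.filter_true_of_mem fun d hd => not_not.1 (he hd)] at hcon
    omega
  obtain ⟨d, hd, hdmin⟩ := (S.filter fun d => ¬ Q d ≤ t).exists_min_image Q hU
  have hle : Q d ≤ medianOn S Q := by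
    refine le_csInf hne fun m hm => ?_
    by_contra hlt
    have hsub : (S.filter fun d => Q d ≤ m) ⊆ S.filter fun d => Q d ≤ t := fun e he => by
      rw [Finset.mem_filter] at he ⊢
      refine ⟨he.1, ?_⟩
      by_contra het
      exact hlt ((hdmin e (Finset.mem_filter.2 ⟨he.1, het⟩)).trans he.2)
    have := Finset.card_le_card hsub
    simp only [Set.mem_ofPred_eq] at hm
    omega
  exact (Finset.mem_filter.1 hd).2 (hle.trans h)

lemma measurable_medianOn {Ω D : Type*} [MeasurableSpace Ω] (S : Finset D) {f : Ω → D → ℝ}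
    (hf : ∀ d, Measurable fun a => f a d) : Measurable fun a => medianOn S (f a) := by
  -- The candidates may run out; the median over the empty set is a constant.
  rcases S.eq_empty_or_nonempty with rfl | hS
  · simp [medianOn]
  refine measurable_of_Iic fun t => ?_
  have e : (fun a => medianOn S (f a)) ⁻¹' Set.Iic t =
      {a | S.card ≤ 2 * ∑ d ∈ S, if f a d ≤ t then 1 else 0} := by
    ext a
    simp only [Set.mem_preimage, Set.mem_Iic, Set.mem_ofPred_eq, medianOn_le_iff hS,
      Finset.card_filter]
  rw [e]
  exact measurableSet_le measurable_const (measurable_const.mul (Finset.measurable_sum _ fun d _ =>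
    Measurable.ite (measurableSet_le (hf d) measurable_const) measurable_const measurable_const))

/-! ### The Median Mechanism as a sequence of sparse vector tests -/

namespace MedianMechanism

variable {n : ℕ} {X : Type*}

/-- The public state of the Median Mechanism: which profiles are candidates, the number of hard
rounds, the number of answers, and the answers. -/
abbrev PublicState (n : ℕ) (X : Type*) := ((Fin n → X) → Bool) × ℕ × ℕ × (ℕ → ℝ)

namespace PublicState

/-- The list of the answers. -/
def history (γ : PublicState n X) : List ℝ := List.ofFn fun i : Fin γ.2.2.1 => γ.2.2.2 i

/-- The set of candidates. -/
def candidates [Fintype X] (γ : PublicState n X) : Finset (Fin n → X) :=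
  Finset.univ.filter fun d => γ.1 d = true

/-- The answers after one more answer `a`. -/
def append (γ : PublicState n X) (a : ℝ) : ℕ × (ℕ → ℝ) :=
  (γ.2.2.1 + 1, fun j => if j = γ.2.2.1 then a else γ.2.2.2 j)

/-- The median of the next query over the candidates. -/
noncomputable def median [Fintype X] (q : List ℝ → Query n X) (γ : PublicState n X) : ℝ :=
  medianOn γ.candidates (q γ.history)

lemma history_append (κ : (Fin n → X) → Bool) (k : ℕ) (γ : PublicState n X) (a : ℝ) :
    history (κ, k, γ.append a) = γ.history ++ [a] := by
  simp only [history, append, List.ofFn_succ', List.concat_eq_append, Fin.val_last, if_true]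
  congr 2
  funext i
  simp [i.2.ne]

lemma getD_history (γ : PublicState n X) (j : ℕ) :
    γ.history.getD j 0 = if j < γ.2.2.1 then γ.2.2.2 j else 0 := by
  simp only [history]
  split_ifs with h
  · simp [h]
  · rw [List.getD_eq_default]
    simpa using h

lemma measurable_append : Measurable fun p : PublicState n X × ℝ => p.1.append p.2 := by
  unfold append
  refine Measurable.prodMk (by fun_prop) (measurable_pi_lambda _ fun j => ?_)
  exact Measurable.ite (measurableSet_eq_fun measurable_const (by fun_prop)) (by fun_prop)
    (by fun_prop)

lemma measurable_transcript (t : ℕ) :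
    Measurable fun (γ : PublicState n X) (r : Fin t) => γ.history.getD r 0 := by
  refine measurable_pi_lambda _ fun r => ?_
  simp only [getD_history]
  exact Measurable.ite (measurableSet_lt measurable_const (by fun_prop)) (by fun_prop)
    measurable_const

variable {q : List ℝ → Query n X}

/-- The measurability of `q` is given for each length of the history separately; there are countably
many lengths. -/
lemma measurable_query
    (hq : ∀ (r : ℕ) (x : Fin n → X), Measurable fun a : Fin r → ℝ => q (List.ofFn a) x)
    (x : Fin n → X) : Measurable fun γ : PublicState n X => q γ.history x := by
  have h : Measurable fun p : ℕ × (ℕ → ℝ) => q (List.ofFn fun i : Fin p.1 => p.2 i) x :=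
    measurable_from_prod_countable_right fun r =>
      (hq r x).comp (measurable_pi_lambda _ fun i => measurable_pi_apply _)
  exact h.comp (measurable_snd.comp measurable_snd)

lemma measurable_median [Fintype X]
    (hq : ∀ (r : ℕ) (x : Fin n → X), Measurable fun a : Fin r → ℝ => q (List.ofFn a) x) :
    Measurable (median q) := by
  -- There are finitely many candidate sets, so the set can be held fixed.
  refine measurable_from_prod_countable_right fun κ => ?_
  exact measurable_medianOn (candidates (κ, (0, 0, fun _ => 0))) fun d =>
    (measurable_query hq d).comp measurable_prodMk_left

end PublicState

open PublicState

/-- The way in which the public state of the Median Mechanism changes. -/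
noncomputable def dynamics [Fintype X] (q : List ℝ → Query n X)
    (hq : ∀ (r : ℕ) (x : Fin n → X), Measurable fun a : Fin r → ℝ => q (List.ofFn a) x) :
    SparseVector (PublicState n X) where
  easy γ := (γ.1, γ.2.1, γ.append (median q γ))
  hard γ a := (fun d => γ.1 d && if median q γ < a then decide (median q γ < q γ.history d)
    else decide (q γ.history d < median q γ), γ.2.1 + 1, γ.append a)
  rank γ := γ.2.1
  cap := maxHardRounds n X
  measurable_easy := measurable_fst.prodMk ((measurable_fst.comp measurable_snd).prodMk
    (measurable_append.comp (measurable_id.prodMk (measurable_median hq))))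
  measurable_hard := by
    have hmed : Measurable fun p : PublicState n X × ℝ => median q p.1 :=
      (measurable_median hq).comp measurable_fst
    have hqd : ∀ d, Measurable fun p : PublicState n X × ℝ => q p.1.history d := fun d =>
      (measurable_query hq d).comp measurable_fst
    refine Measurable.prodMk (measurable_pi_lambda _ fun d => ?_)
      (Measurable.prodMk (by fun_prop) measurable_append)
    refine (Measurable.of_discrete (f := fun b : Bool × Bool => b.1 && b.2)).comp
      (Measurable.prodMk (by fun_prop) ?_)
    refine Measurable.ite (measurableSet_lt hmed measurable_snd) ?_ ?_
    · exact measurable_to_bool (by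
        simpa [Set.preimage] using measurableSet_lt hmed (hqd d))
    · exact measurable_to_bool (by
        simpa [Set.preimage] using measurableSet_lt (hqd d) hmed)
  measurable_rank := by fun_prop
  rank_easy _ := rfl
  rank_hard _ _ := rfl

/-- The state of the Median Mechanism and the answers it has given. -/
def toState [Fintype X] (p : PublicState n X × Bool × ℝ) : MedianState n X × List ℝ :=
  (⟨p.1.candidates, p.1.2.1, bif p.2.1 then some p.2.2 else none⟩, p.1.history)

/-- The mechanism is simulated step by step. The deterministic part of the threshold is moved into
the tested level, so that the test is against pure noise. -/
lemma round_toState [Fintype X] (ε δ lam β : ℝ) (R : ℕ) (q : List ℝ → Query n X)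
    (hq : ∀ (r : ℕ) (x : Fin n → X), Measurable fun a : Fin r → ℝ => q (List.ofFn a) x)
    (x : Fin n → X) (p : PublicState n X × Bool × ℝ) (c : ℝ × ℝ × ℝ) :
    (medianMechanism n X ε δ lam β R).round q x (toState p) c =
      toState ((dynamics q hq).step
        (fun γ => |q γ.history x - median q γ| -
          16 * noiseScale n X ε δ lam * Real.log (3 * R / β)) (fun γ => q γ.history x) p c) := by
  obtain ⟨γ, b, ρ⟩ := p
  have hρ : (bif b then some ρ else none).getD c.1 = bif b then ρ else c.1 := by cases b <;> rfl
  simp only [OnlineMechanism.round, medianMechanism, SparseVector.step, toState, hρ]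
  have hiff : ∀ u : ℝ, |q γ.history x - median q γ| -
      16 * noiseScale n X ε δ lam * Real.log (3 * R / β) + c.2.1 < u ↔
      |q γ.history x - median q γ| + c.2.1 <
        16 * noiseScale n X ε δ lam * Real.log (3 * R / β) + u := fun u => by
    constructor <;> intro h <;> linarith
  simp only [hiff]
  have hcap : (dynamics q hq).cap = maxHardRounds n X := rfl
  have hrank : (dynamics q hq).rank γ = γ.2.1 := rfl
  have hmed : medianOn γ.candidates (q γ.history) = median q γ := rfl
  simp only [hcap, hrank, hmed]
  split_ifs with h1 h2 h3
  · exact Prod.ext rfl (history_append _ _ _ _).symm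
  · exact Prod.ext rfl (history_append _ _ _ _).symm
  · refine Prod.ext ?_ (history_append _ _ _ _).symm
    simp [dynamics, candidates, h3, Finset.filter_filter]
  · refine Prod.ext ?_ (history_append _ _ _ _).symm
    simp [dynamics, candidates, h3, Finset.filter_filter]

/-- The public state at the beginning. -/
def start (n : ℕ) (X : Type*) : PublicState n X := (fun _ => true, 0, 0, fun _ => 0)

lemma answers_eq_history [Fintype X] (ε δ lam β : ℝ) (R t : ℕ) (q : List ℝ → Query n X)
    (hq : ∀ (r : ℕ) (x : Fin n → X), Measurable fun a : Fin r → ℝ => q (List.ofFn a) x)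
    (x : Fin n → X) (ω : Fin t → ℝ × ℝ × ℝ) :
    (medianMechanism n X ε δ lam β R).answers q x ω =
      ((List.ofFn ω).foldl ((dynamics q hq).step
        (fun γ => |q γ.history x - median q γ| -
          16 * noiseScale n X ε δ lam * Real.log (3 * R / β)) (fun γ => q γ.history x))
        (start n X, false, 0)).1.history := by
  have h0 : ((medianMechanism n X ε δ lam β R).init, ([] : List ℝ)) =
      toState (start n X, false, 0) := by
    simp [medianMechanism, toState, start, candidates, history]
  change ((List.ofFn ω).foldl ((medianMechanism n X ε δ lam β R).round q x)
    ((medianMechanism n X ε δ lam β R).init, [])).2 = _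
  rw [h0]
  have := List.foldl_hom toState (l := List.ofFn ω) (init := (start n X, false, (0 : ℝ)))
    (H := fun p c => round_toState ε δ lam β R q hq x p c)
  exact congrArg Prod.snd this

lemma measure_answers_mem [Fintype X] {ε δ lam β : ℝ} (hs : 0 < noiseScale n X ε δ lam) (R t : ℕ)
    (q : List ℝ → Query n X)
    (hq : ∀ (r : ℕ) (x : Fin n → X), Measurable fun a : Fin r → ℝ => q (List.ofFn a) x)
    (x : Fin n → X) {B : Set (Fin t → ℝ)} (hB : MeasurableSet B) :
    (medianMechanism n X ε δ lam β R).coins t {ω |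
        (fun r : Fin t => ((medianMechanism n X ε δ lam β R).answers q x ω).getD r 0) ∈ B} =
      (dynamics q hq).value (noiseScale n X ε δ lam)
        (fun γ => |q γ.history x - median q γ| -
          16 * noiseScale n X ε δ lam * Real.log (3 * R / β)) (fun γ => q γ.history x)
        (B.indicator 1 ∘ fun γ (r : Fin t) => γ.history.getD r 0) t (start n X, false, 0) := by
  have := SparseVector.isProbabilityMeasure_coinLaw hs
  have hg : Measurable fun γ : PublicState n X => |q γ.history x - median q γ| -
      16 * noiseScale n X ε δ lam * Real.log (3 * R / β) :=
    (continuous_abs.measurable.comp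
      ((measurable_query hq x).sub (measurable_median hq))).sub_const _
  have htr := measurable_transcript (n := n) (X := X) t
  have hF : Measurable ((B.indicator (1 : (Fin t → ℝ) → ENNReal)) ∘
      fun (γ : PublicState n X) (r : Fin t) => γ.history.getD r 0) :=
    (measurable_one.indicator hB).comp htr
  have hstep := (dynamics q hq).measurable_step hg (measurable_query hq x)
  have hfold := (measurable_foldl_ofFn hstep t).comp
    (measurable_prodMk_left (x := (start n X, false, (0 : ℝ))))
  have hE : MeasurableSet {ω : Fin t → ℝ × ℝ × ℝ |
      (fun r : Fin t => ((List.ofFn ω).foldl ((dynamics q hq).step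
        (fun γ => |q γ.history x - median q γ| -
          16 * noiseScale n X ε δ lam * Real.log (3 * R / β)) (fun γ => q γ.history x))
        (start n X, false, 0)).1.history.getD r 0) ∈ B} :=
    (htr.comp (measurable_fst.comp hfold)) hB
  have hF' : Measurable fun p : PublicState n X × Bool × ℝ => (B.indicator (1 : (Fin t → ℝ) →
      ENNReal) ∘ fun (γ : PublicState n X) (r : Fin t) => γ.history.getD r 0) p.1 :=
    hF.comp measurable_fst
  rw [SparseVector.value, ← lintegral_foldl_ofFn hstep hF']
  refine Eq.trans (congrArg _ (Set.ext fun ω => ?_)) (lintegral_indicator_one hE).symm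
  have hω := answers_eq_history ε δ lam β R t q hq x ω
  exact iff_of_eq (congrArg (· ∈ B) (funext fun r => congrArg (fun l => List.getD l r 0) hω))

end MedianMechanism

/-! ### The privacy of the Median Mechanism -/

lemma maxHardRounds_pos (n : ℕ) (X : Type*) [Fintype X] : 0 < maxHardRounds n X :=
  Nat.succ_pos _

lemma one_lt_log_four_div {δ : ℝ} (hδ : 0 < δ) (hδ1 : δ ≤ 1) : 1 < Real.log (4 / δ) := by
  rw [Real.lt_log_iff_exp_lt (by positivity), lt_div_iff₀ hδ]
  nlinarith [Real.exp_one_lt_d9, Real.exp_pos 1]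

lemma noiseScale_pos (n : ℕ) (X : Type*) [Fintype X] {ε δ lam : ℝ} (hε : 0 < ε) (hδ : 0 < δ)
    (hδ1 : δ ≤ 1) (hlam : 0 < lam) : 0 < noiseScale n X ε δ lam := by
  have := one_lt_log_four_div hδ hδ1
  have : (0 : ℝ) < maxHardRounds n X := by exact_mod_cast maxHardRounds_pos n X
  unfold noiseScale
  positivity

/-- The calibration of the noise: `2 c` factors `exp (p η² / 2)` with `η² = ε² / (32 c log (4 / δ))`
and `p = 8 log (4 / δ) / ε`. -/
lemma momentFactor_noiseScale_pow (n : ℕ) (X : Type*) [Fintype X] {ε δ lam : ℝ} (hε : 0 < ε)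
    (hδ : 0 < δ) (hδ1 : δ ≤ 1) (hlam : 0 < lam) :
    (SparseVector.momentFactor (noiseScale n X ε δ lam) lam (8 * Real.log (4 / δ) / ε) ^ 2) ^
      maxHardRounds n X = ENNReal.ofReal (Real.exp (ε / 4)) := by
  have hL : 0 < Real.log (4 / δ) := zero_lt_one.trans (one_lt_log_four_div hδ hδ1)
  have hc : (0 : ℝ) < maxHardRounds n X := by exact_mod_cast maxHardRounds_pos n X
  rw [SparseVector.momentFactor, ← pow_mul, ← ENNReal.ofReal_pow (Real.exp_pos _).le,
    ← Real.exp_nat_mul, noiseScale]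
  congr 2
  have hc8 : 0 < 8 * maxHardRounds n X * Real.log (4 / δ) := by positivity
  have e : (lam / (2 * (lam / ε * Real.sqrt (8 * maxHardRounds n X * Real.log (4 / δ))))) ^ 2 =
      ε ^ 2 / (4 * (8 * maxHardRounds n X * Real.log (4 / δ))) := by
    have hsp := Real.sqrt_pos.2 hc8
    nth_rw 2 [← Real.sq_sqrt hc8.le]
    generalize Real.sqrt (8 * maxHardRounds n X * Real.log (4 / δ)) = w at hsp ⊢
    field_simp
    norm_num
  rw [e]
  push_cast
  field_simp

/-- A bound by a power slightly less than one is a bound of the kind that differential privacy asks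
for. -/
lemma exp_mul_rpow_le {ε δ q : ℝ} (hε : 0 < ε) (hε1 : ε ≤ 1) (hδ : 0 < δ) (hδ1 : δ ≤ 1)
    (hpq : (8 * Real.log (4 / δ) / ε).HolderConjugate q) (t : ENNReal) :
    ENNReal.ofReal (Real.exp (ε / 4)) * t ^ (1 / q) ≤
      ENNReal.ofReal (Real.exp ε) * t + ENNReal.ofReal δ := by
  set L := Real.log (4 / δ) with hLdef
  have hL : 1 < L := one_lt_log_four_div hδ hδ1
  have hq := hpq.symm.pos
  have hp := hpq.pos
  have hqinv : 1 / q = 1 - ε / (8 * L) := by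
    have := hpq.inv_add_inv_eq_one
    rw [inv_div] at this
    rw [one_div]
    linarith
  -- The product is split so that Young's inequality makes `b ^ q` exactly the multiplicative term
  -- of the privacy bound; the rest, `a ^ p`, has to be at most `δ`.
  set a := ENNReal.ofReal (Real.exp (ε / 4 - ε * (1 / q))) with ha
  set b := (ENNReal.ofReal (Real.exp ε) * t) ^ (1 / q) with hb
  have hab : ENNReal.ofReal (Real.exp (ε / 4)) * t ^ (1 / q) = a * b := by
    rw [ha, hb, ENNReal.mul_rpow_of_nonneg _ _ (by positivity),
      ENNReal.ofReal_rpow_of_pos (Real.exp_pos _), ← mul_assoc,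
      ← ENNReal.ofReal_mul (Real.exp_pos _).le, ← Real.exp_mul, ← Real.exp_add]
    congr 3
    ring
  have hbq : b ^ q = ENNReal.ofReal (Real.exp ε) * t := by
    rw [hb, ← ENNReal.rpow_mul, one_div_mul_cancel hq.ne', ENNReal.rpow_one]
  have hap : a ^ (8 * L / ε) ≤ ENNReal.ofReal δ := by
    rw [ha, ENNReal.ofReal_rpow_of_pos (Real.exp_pos _), ← Real.exp_mul]
    refine ENNReal.ofReal_le_ofReal ?_
    have e : (ε / 4 - ε * (1 / q)) * (8 * L / ε) = ε - 6 * L := by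
      rw [hqinv]
      field_simp
      ring
    rw [e]
    -- Here `ε ≤ 1 < L`.
    calc Real.exp (ε - 6 * L) ≤ Real.exp (-L) := Real.exp_le_exp.2 (by linarith)
      _ = δ / 4 := by rw [Real.exp_neg, hLdef, Real.exp_log (by positivity), inv_div]
      _ ≤ δ := by linarith
  have hone : ∀ {r : ℝ}, 1 < r → ∀ u : ENNReal, u / ENNReal.ofReal r ≤ u := fun hr u =>
    ENNReal.div_le_of_le_mul (le_mul_of_one_le_right' (ENNReal.one_le_ofReal.2 hr.le))
  calc _ = a * b := hab
    _ ≤ a ^ (8 * L / ε) / ENNReal.ofReal (8 * L / ε) + b ^ q / ENNReal.ofReal q :=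
      ENNReal.young_inequality a b hpq
    _ ≤ a ^ (8 * L / ε) + b ^ q := add_le_add (hone hpq.lt _) (hone hpq.symm.lt _)
    _ ≤ ENNReal.ofReal δ + ENNReal.ofReal (Real.exp ε) * t := add_le_add hap hbq.le
    _ = _ := add_comm _ _

/-- `R` and `β` enter only through a constant in the threshold, which cancels between neighbouring
data; hence the number `t` of rounds is independent of `R`. -/
theorem medianMechanism_isPrivate (n : ℕ) (X : Type*) [Fintype X] {ε δ lam : ℝ} (β : ℝ)
    (hε : 0 < ε) (hε1 : ε ≤ 1) (hδ : 0 < δ) (hδ1 : δ ≤ 1) (hlam : 0 < lam) (R t : ℕ) :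
    (medianMechanism n X ε δ lam β R).IsPrivate ε δ lam t := by
  intro q hsens hq i x y B hB
  have hs := noiseScale_pos n X hε hδ hδ1 hlam
  have hL := one_lt_log_four_div hδ hδ1
  have hp : 1 < 8 * Real.log (4 / δ) / ε := by
    rw [lt_div_iff₀ hε]
    linarith
  have hpq := Real.HolderConjugate.conjExponent hp
  rw [MedianMechanism.measure_answers_mem hs R t q hq _ hB,
    MedianMechanism.measure_answers_mem hs R t q hq _ hB]
  refine le_trans ?_ (exp_mul_rpow_le hε hε1 hδ hδ1 hpq _)
  have hQ := fun x => MedianMechanism.PublicState.measurable_query (X := X) hq x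
  have hmed := MedianMechanism.PublicState.measurable_median hq
  have hlevel : ∀ x : Fin n → X, Measurable fun γ : MedianMechanism.PublicState n X =>
      |q γ.history x - γ.median q| - 16 * noiseScale n X ε δ lam * Real.log (3 * R / β) :=
    fun x => (continuous_abs.measurable.comp ((hQ x).sub hmed)).sub_const _
  have hF := (measurable_one.indicator hB : Measurable (B.indicator (1 : (Fin t → ℝ) → ENNReal))).comp
    (MedianMechanism.PublicState.measurable_transcript (n := n) (X := X) t)
  have key := (MedianMechanism.dynamics q hq).value_le_moment hs hlam.le hpq
    (hlevel x) (hQ x) (hlevel (Function.update x i y)) (hQ (Function.update x i y))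
    -- The median depends on the public state alone, so the tested error inherits the sensitivity of
    -- the query.
    (fun γ => by
      rw [sub_sub_sub_cancel_right]
      refine (abs_abs_sub_abs_le_abs_sub _ _).trans ?_
      rw [sub_sub_sub_cancel_right]
      exact hsens _ i x y)
    (fun γ => hsens _ i x y) hF (maxHardRounds n X) (γ := MedianMechanism.start n X)
    (Nat.le_add_left _ _) t
  rw [momentFactor_noiseScale_pow n X hε hδ hδ1 hlam] at key
  -- An indicator equals its `q`-th power, so the higher moment is a probability again.
  have hpow : (fun γ : MedianMechanism.PublicState n X => (B.indicator (1 : (Fin t → ℝ) → ENNReal) ∘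
      fun (γ : MedianMechanism.PublicState n X) (r : Fin t) => γ.history.getD r 0) γ ^
        (8 * Real.log (4 / δ) / ε).conjExponent) =
      B.indicator 1 ∘ fun γ r => γ.history.getD r 0 := by
    funext γ
    by_cases h : (fun r : Fin t => γ.history.getD r 0) ∈ B
    · simp only [Function.comp_apply, Set.indicator_of_mem h, Pi.one_apply, ENNReal.one_rpow]
    · simp only [Function.comp_apply, Set.indicator_of_notMem h,
        ENNReal.zero_rpow_of_pos hpq.symm.pos]
  rwa [hpow] at key

/-! ### The loss queries -/

/-- If one player changes her mixed strategy, and her action changes `f` by at most `c`, then the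
expectation of `f` changes by at most `c`. -/
lemma abs_sub_sum_prod_mul_le {ι : Type*} [Fintype ι] [DecidableEq ι] {A : ι → Type*}
    [∀ i, Fintype (A i)] {p p' : (i : ι) → stdSimplex ℝ (A i)} {k : ι}
    (hp : ∀ i, i ≠ k → p' i = p i) {f : ((i : ι) → A i) → ℝ} {c : ℝ}
    (hf : ∀ a b, |f a - f (Function.update a k b)| ≤ c) :
    |∑ a, (∏ i, p i (a i)) * f a - ∑ a, (∏ i, p' i (a i)) * f a| ≤ c := by
  have hsplit : ∀ (r : (i : ι) → stdSimplex ℝ (A i)) (a : (i : ι) → A i),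
      ∏ i, r i (a i) = r k (a k) * ∏ i ∈ Finset.univ.erase k, r i (a i) := fun r a =>
    (Finset.mul_prod_erase _ _ (Finset.mem_univ k)).symm
  set W : ((i : ι) → A i) → ℝ := fun a => ∏ i ∈ Finset.univ.erase k, p i (a i)
  have hW' : ∀ a, ∏ i ∈ Finset.univ.erase k, p' i (a i) = W a := fun a =>
    Finset.prod_congr rfl fun i hi => by rw [hp i (Finset.ne_of_mem_erase hi)]
  have hWup : ∀ a b, W (Function.update a k b) = W a := fun a b =>
    Finset.prod_congr rfl fun i hi => by rw [Function.update_of_ne (Finset.ne_of_mem_erase hi)]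
  have hW0 : ∀ a, 0 ≤ W a := fun a => Finset.prod_nonneg fun i _ => (p i).2.1 _
  have htot : ∑ a, p k (a k) * W a = 1 := by
    rw [← Finset.sum_congr rfl fun a _ => hsplit p a, ← Fintype.prod_sum]
    exact Finset.prod_eq_one fun i _ => (p i).2.2
  have hsum : ∀ i (r : stdSimplex ℝ (A i)), ∑ b, r b = 1 := fun i r => r.2.2
  -- A coupling: draw `a` from `p` and an independent `b` from `p' k`; replacing coordinate `k` of
  -- `a` by `b` gives a profile with law `p'`. The involution exchanges `b` with that coordinate.
  let swap : ((i : ι) → A i) × A k → ((i : ι) → A i) × A k :=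
    fun z => (Function.update z.1 k z.2, z.1 k)
  have hswap : Function.Involutive swap := fun z => by simp [swap]
  have h1 : ∑ a, (∏ i, p i (a i)) * f a =
      ∑ z : ((i : ι) → A i) × A k, p k (z.1 k) * W z.1 * p' k z.2 * f z.1 := by
    rw [Fintype.sum_prod_type]
    refine Finset.sum_congr rfl fun a _ => ?_
    change _ = ∑ b, p k (a k) * W a * p' k b * f a
    rw [hsplit p, ← Finset.sum_mul, ← Finset.mul_sum, hsum, mul_one]
  have h2 : ∑ a, (∏ i, p' i (a i)) * f a = ∑ z : ((i : ι) → A i) × A k,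
      p k (z.1 k) * W z.1 * p' k z.2 * f (Function.update z.1 k z.2) := by
    rw [← Equiv.sum_comp hswap.toPerm, Fintype.sum_prod_type]
    refine Finset.sum_congr rfl fun a _ => ?_
    simp only [Function.Involutive.coe_toPerm, swap, Function.update_self, hWup,
      Function.update_idem, Function.update_eq_self]
    rw [hsplit p', hW']
    have e : ∀ b, p k b * W a * p' k (a k) * f a = p k b * (p' k (a k) * W a * f a) :=
      fun b => by ring
    simp_rw [e]
    rw [← Finset.sum_mul, hsum, one_mul]
  rw [h1, h2, ← Finset.sum_sub_distrib]
  have hnn : ∀ z : ((i : ι) → A i) × A k, 0 ≤ p k (z.1 k) * W z.1 * p' k z.2 := fun z =>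
    mul_nonneg (mul_nonneg ((p k).2.1 _) (hW0 _)) ((p' k).2.1 _)
  calc _ ≤ ∑ z : ((i : ι) → A i) × A k, |p k (z.1 k) * W z.1 * p' k z.2 * f z.1 -
        p k (z.1 k) * W z.1 * p' k z.2 * f (Function.update z.1 k z.2)| :=
        Finset.abs_sum_le_sum_abs _ _
    _ ≤ ∑ z : ((i : ι) → A i) × A k, p k (z.1 k) * W z.1 * p' k z.2 * c := by
      refine Finset.sum_le_sum fun z _ => ?_
      rw [← mul_sub, abs_mul, abs_of_nonneg (hnn z)]
      exact mul_le_mul_of_nonneg_left (hf _ _) (hnn z)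
    _ = c := by
      rw [← Finset.sum_mul, Fintype.sum_prod_type]
      simp_rw [← Finset.mul_sum, hsum, mul_one]
      rw [htot, one_mul]

namespace Game

variable {n : ℕ} {T : Type*} {A : Fin n → Type*} [∀ i, Fintype (A i)]

/-- With the losses held fixed, the report of player `k` influences only her own mixed strategy. -/
lemma lossQuery_isSensitive (G : Game n T A) {lam : ℝ} (hlam : 0 ≤ lam) (hG : G.IsLarge lam)
    (alg : (i : Fin n) → LearningAlgorithm (A i)) (Λ : ℕ → LossIndex T A → ℝ) (t : ℕ)
    (w : LossIndex T A) : IsSensitive lam (G.lossQuery alg Λ t w) := by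
  intro k x y
  obtain ⟨⟨i, j⟩, τ⟩ := w
  unfold lossQuery
  rw [sub_sub_sub_cancel_left, abs_sub_comm]
  refine abs_sub_sum_prod_mul_le (p := fun i' => G.strategy alg Λ i' (x i') t)
    (p' := fun i' => G.strategy alg Λ i' (Function.update x k y i') t) (k := k)
    (f := fun a => G.utility i τ (Function.update a i j)) (fun i' hi' => ?_) fun a b => ?_
  · simp only [Function.update_of_ne hi']
  -- The action of player `i` is overwritten by `j`, so her own report has no effect.
  · by_cases h : k = i
    · subst h
      simpa using hlam
    · rw [Function.update_comm h]
      exact hG k i h τ _ b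

lemma querier_isSensitive (G : Game n T A) {lam : ℝ} (hlam : 0 ≤ lam) (hG : G.IsLarge lam)
    (alg : (i : Fin n) → LearningAlgorithm (A i)) {m : ℕ} (e : LossIndex T A ≃ Fin m)
    (h : List ℝ) : IsSensitive lam (G.querier alg e h) := by
  unfold querier
  split_ifs
  · exact G.lossQuery_isSensitive hlam hG alg _ _ _
  · intro i x y
    simpa using hlam

lemma measurable_strategy (G : Game n T A) {alg : (i : Fin n) → LearningAlgorithm (A i)}
    (halg : ∀ i, Measurable fun p : stdSimplex ℝ (A i) × (A i → ℝ) => alg i p.1 p.2)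
    {Ω : Type*} [MeasurableSpace Ω] {Λ : Ω → ℕ → LossIndex T A → ℝ}
    (hΛ : ∀ t w, Measurable fun ω => Λ ω t w) (i : Fin n) (r : Option T) (t : ℕ) :
    Measurable fun ω => G.strategy alg (Λ ω) i r t := by
  induction t with
  | zero => cases r <;> exact measurable_const
  | succ t ih =>
    cases r with
    | none => exact measurable_const
    | some τ => exact (halg i).comp (ih.prodMk (measurable_pi_lambda _ fun j => hΛ t _))

lemma measurable_querier (G : Game n T A) {alg : (i : Fin n) → LearningAlgorithm (A i)}
    (halg : ∀ i, Measurable fun p : stdSimplex ℝ (A i) × (A i → ℝ) => alg i p.1 p.2)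
    {m : ℕ} (e : LossIndex T A ≃ Fin m) (r : ℕ) (x : Fin n → Option T) :
    Measurable fun a : Fin r → ℝ => G.querier alg e (List.ofFn a) x := by
  by_cases hm : 0 < m
  · have hΛ : ∀ t w, Measurable fun a : Fin r → ℝ => recordedLosses e (List.ofFn a) t w := by
      intro t w
      unfold recordedLosses
      by_cases h : t * m + e w < r
      · have e1 : ∀ a : Fin r → ℝ, (List.ofFn a).getD (t * m + e w) 0 = a ⟨_, h⟩ := fun a => by
          simp [h]
        simp only [e1]
        fun_prop
      · have e1 : ∀ a : Fin r → ℝ, (List.ofFn a).getD (t * m + e w) 0 = 0 := fun a =>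
          List.getD_eq_default _ _ (by simpa using h)
        simp only [e1]
        exact measurable_const
    have e2 : ∀ a : Fin r → ℝ, G.querier alg e (List.ofFn a) x =
        G.lossQuery alg (recordedLosses e (List.ofFn a)) (r / m)
          (e.symm ⟨r % m, Nat.mod_lt _ hm⟩) x := fun a => by
      simp only [querier, hm, dif_pos, List.length_ofFn]
    simp only [e2, lossQuery]
    refine measurable_const.sub (Finset.measurable_sum _ fun a _ => Measurable.mul_const ?_ _)
    refine Finset.measurable_prod _ fun i _ => ?_
    exact (measurable_pi_apply _).comp
      (measurable_subtype_coe.comp (G.measurable_strategy halg hΛ i (x i) _))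
  · simp only [querier, hm, dif_neg, not_false_eq_true]
    exact measurable_const

end Game

/-! ### Joint privacy -/

lemma OnlineMechanism.length_answers {n : ℕ} {X : Type*} (M : OnlineMechanism n X)
    (q : List ℝ → Query n X) {R : ℕ} (x : Fin n → X) (ω : Fin R → M.Coin) :
    (M.answers q x ω).length = R := by
  have h : ∀ (l : List M.Coin) (p : M.State × List ℝ),
      (l.foldl (M.round q x) p).2.length = p.2.length + l.length := by
    intro l
    induction l with
    | nil => simp
    | cons c l ih =>
      intro p
      rw [List.foldl_cons, ih]
      simp only [OnlineMechanism.round, List.length_append, List.length_cons, List.length_nil]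
      omega
  simp [answers, h]

/-- The billboard argument: the joint output of the others is a post-processing of a private
transcript. -/
theorem Game.nrMedian_isJointlyDifferentiallyPrivate {n : ℕ} {T : Type*} {A : Fin n → Type*}
    [∀ i, Fintype (A i)] (G : Game n T A) {ε δ lam : ℝ} (hlam : 0 ≤ lam) (hG : G.IsLarge lam)
    {alg : (i : Fin n) → LearningAlgorithm (A i)}
    (halg : ∀ i, Measurable fun p : stdSimplex ℝ (A i) × (A i → ℝ) => alg i p.1 p.2)
    (N : ℕ) {m : ℕ} (e : Game.LossIndex T A ≃ Fin m) {M : OnlineMechanism n (Option T)}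
    (hM : M.IsPrivate ε δ lam (N * m)) :
    IsJointlyDifferentiallyPrivate ε δ (M.coins (N * m)) (G.nrMedian alg e N M) := by
  intro i x y B hB
  let Λ : (Fin (N * m) → ℝ) → ℕ → LossIndex T A → ℝ := fun v t w =>
    if h : t * m + e w < N * m then v ⟨_, h⟩ else 0
  have hΛ : ∀ t w, Measurable fun v => Λ v t w := fun t w => by
    by_cases h : t * m + e w < N * m
    · simp only [Λ, h, dif_pos]
      fun_prop
    · simp only [Λ, h, dif_neg, not_false_eq_true]
      exact measurable_const
  -- The reports are frozen at `x`. This is harmless for the players `j ≠ i`, and makes `post` the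
  -- same map before and after the deviation.
  let post : (Fin (N * m) → ℝ) → (j : {j : Fin n // j ≠ i}) → Fin N → stdSimplex ℝ (A j) :=
    fun v j t => G.strategy alg (Λ v) j (x j) t
  have hpost : Measurable post := measurable_pi_lambda _ fun j => measurable_pi_lambda _ fun t =>
    G.measurable_strategy halg hΛ j (x j) t
  have hrec : ∀ (x' : Fin n → Option T) ω, G.nrMedianShared alg e N M x' ω =
      Λ fun r => (M.answers (G.querier alg e) x' ω).getD r 0 := by
    intro x' ω
    funext t w
    simp only [nrMedianShared, recordedLosses, Λ]
    split_ifs with h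
    · rfl
    · exact List.getD_eq_default _ _ (by rw [M.length_answers]; exact not_lt.1 h)
  have hout : ∀ x' : Fin n → Option T, (∀ j, j ≠ i → x' j = x j) → ∀ ω,
      (fun j : {j : Fin n // j ≠ i} => G.nrMedian alg e N M x' ω j) =
        post fun r => (M.answers (G.querier alg e) x' ω).getD r 0 := by
    intro x' hx' ω
    funext j t
    simp only [nrMedian, post, hrec, hx' j j.2]
  simp only [hout x fun _ _ => rfl,
    hout (Function.update x i y) fun j hj => Function.update_of_ne hj _ _]
  exact hM (G.querier alg e) (G.querier_isSensitive hlam hG alg e)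
    (G.measurable_querier halg e) i x y (post ⁻¹' B) (hpost hB)

theorem mainTheorem12 {n : ℕ} {T : Type*} [Fintype T] {A : Fin n → Type*} [∀ i, Fintype (A i)]
    (G : Game n T A) (ε δ lam β : ℝ) (hε : 0 < ε) (hε1 : ε ≤ 1) (hδ : 0 < δ) (hδ1 : δ ≤ 1)
    (hlam : 0 < lam) (hlam1 : lam ≤ 1) (hβ : 0 < β) (hβ1 : β ≤ 1) (hG : G.IsLarge lam)
    (alg : (i : Fin n) → LearningAlgorithm (A i))
    (halg : ∀ i, Measurable fun p : stdSimplex ℝ (A i) × (A i → ℝ) => alg i p.1 p.2)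
    (N m : ℕ) (e : Game.LossIndex T A ≃ Fin m) :
    IsJointlyDifferentiallyPrivate ε δ
        ((medianMechanism n (Option T) ε δ lam β (N * m)).coins (N * m))
        (G.nrMedian alg e N (medianMechanism n (Option T) ε δ lam β (N * m))) ∧
      ∀ M : OnlineMechanism n (Option T), IsProbabilityMeasure M.law →
        M.IsPrivate ε δ lam (N * m) →
        IsJointlyDifferentiallyPrivate ε δ (M.coins (N * m)) (G.nrMedian alg e N M) :=
  ⟨G.nrMedian_isJointlyDifferentiallyPrivate hlam.le hG halg N e
    (medianMechanism_isPrivate n (Option T) β hε hε1 hδ hδ1 hlam (N * m) (N * m)),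
    fun _ _ hM => G.nrMedian_isJointlyDifferentiallyPrivate hlam.le hG halg N e hM⟩
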